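/- Consider a single-server first-come-first-served queue with independent sequences of i.i.d. random variables: inter-arrival times $X_k$ of the updates, exponential with rate $\lambda>0$; service times $S_k\ge 0$ with an arbitrary distribution of mean $1/\mu$; and inter-decision times $Z_j$, exponential with rate $\nu>0$. Assume $\rho=\lambda/\mu<1$. Let $t_k=X_1+\dots+X_k$ and $t_k'=\max(t_k,t_{k-1}')+S_k$ ($k\ge1$) be the arrival and departure (reception) times of update $k$, where $t_0=0$ and $t_0'=T_0\ge 0$ is a random initial state independent of the three sequences, let $Y_k=t_k'-t_{k-1}'$ be the inter-departure times, and let $\tau_j=Z_1+\dots+Z_j$ be the decision epochs. A decision made at time $\tau$ uses the most recently received update, i.e. the update with index $\max\{k: t_k'\le\tau\}$; an update is missed if no decision uses it. Let $N_k$ be the number of decisions made in $[t_{k-1}',t_k')$, and let $G_S(s)=\mathbb{E}[e^{sS_k}]$. Put $$p_{\mathrm{mis}}=G_S(-\nu)\,\frac{\rho\nu+\lambda}{\lambda+\nu}.$$ Then: (i) for every initial state, almost surely, the fraction of missed updates among the first $n$ received updates $1,\dots,n$ converges to $p_{\mathrm{mis}}$ as $n\to\infty$; (ii) the recursion $T_k=\max(T_{k-1}-X_k,0)+S_k$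 of the system times $T_k=t_k'-t_k$ has exactly one stationary probability law; (iii) if $T_0$ has the stationary law, then for every $k\ge1$ $$\Pr\{\text{update } k-1 \text{ is missed}\}=\Pr\{N_k=0\}=\mathbb{E}\big[e^{-\nu Y_k}\big]=p_{\mathrm{mis}}.$$ -/

import Mathlib

open MeasureTheory ProbabilityTheory Filter Topology

/-- The random data of a single-server update-and-decide system. Update `0` arrives at time `0`
and spends the time `T₀` in the system (`T₀ = 0` means that the system is empty at time `0`). -/
structure UpdateDecideSystem (Ω : Type*) where
  /-- system time of update `0` -/
  T₀ : Ω → ℝ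
  /-- `X k` is the inter-arrival time between updates `k` and `k + 1` -/
  X : ℕ → Ω → ℝ
  /-- `S k` is the service time of update `k + 1` -/
  S : ℕ → Ω → ℝ
  /-- `Z 0` is the epoch of the first decision, and `Z (j + 1)` is the time that elapses between
  decisions `j` and `j + 1`, when the decisions are numbered from `0` -/
  Z : ℕ → Ω → ℝ

namespace UpdateDecideSystem

variable {Ω : Type*} (Q : UpdateDecideSystem Ω)

/-- The arrival time of update `k`. -/
noncomputable def arrival (k : ℕ) (ω : Ω) : ℝ := ∑ i ∈ Finset.range k, Q.X i ω

/-- The departure time of update `k` (the time at which it is received) under the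
first-come-first-served discipline: the service of update `k + 1` starts as soon as it has arrived
and update `k` has departed. -/
noncomputable def departure : ℕ → Ω → ℝ
  | 0, ω => Q.T₀ ω
  | k + 1, ω => max (Q.arrival (k + 1) ω) (departure k ω) + Q.S k ω

/-- The `j`-th decision epoch (`j = 0, 1, 2, …`). -/
noncomputable def decisionEpoch (j : ℕ) (ω : Ω) : ℝ := ∑ i ∈ Finset.range (j + 1), Q.Z i ω

/-- The inter-departure time between updates `k` and `k + 1`. -/
noncomputable def interDeparture (k : ℕ) (ω : Ω) : ℝ := Q.departure (k + 1) ω - Q.departure k ω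

/-- The number of decisions made between the departures of updates `k` and `k + 1`. -/
noncomputable def numDecisions (k : ℕ) (ω : Ω) : ℕ∞ :=
  {j : ℕ | Q.departure k ω ≤ Q.decisionEpoch j ω ∧
    Q.decisionEpoch j ω < Q.departure (k + 1) ω}.encard

/-- Update `k` is used by the decision made at time `t`: it is the most recent among the updates
that have been received by time `t`. -/
def UsedAt (k : ℕ) (ω : Ω) (t : ℝ) : Prop := IsGreatest {i : ℕ | Q.departure i ω ≤ t} k

/-- Update `k` is missed: it is not used by any decision. -/
def Missed (k : ℕ) (ω : Ω) : Prop := ∀ j : ℕ, ¬ Q.UsedAt k ω (Q.decisionEpoch j ω)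

open Classical in
/-- The number of missed updates among the updates `1, …, n`. -/
noncomputable def numMissed (n : ℕ) (ω : Ω) : ℕ := {k ∈ Finset.Icc 1 n | Q.Missed k ω}.card

/-- The system is an M/G/1/M system with arrival rate `lam`, service time distribution `σ` and
decision rate `ν`: the inter-arrival times are exponential with rate `lam`, the service times have
law `σ`, the inter-decision times are exponential with rate `ν`, and all of these random variables
and the initial state are independent. -/
structure IsMG1M [MeasurableSpace Ω] (P : Measure Ω) (lam : ℝ) (σ : Measure ℝ) (ν : ℝ) : Prop where
  measurable_T₀ : Measurable Q.T₀
  measurable_X : ∀ k, Measurable (Q.X k)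
  measurable_S : ∀ k, Measurable (Q.S k)
  measurable_Z : ∀ k, Measurable (Q.Z k)
  T₀_nonneg : ∀ᵐ ω ∂P, 0 ≤ Q.T₀ ω
  law_X : ∀ k, P.map (Q.X k) = expMeasure lam
  law_S : ∀ k, P.map (Q.S k) = σ
  law_Z : ∀ k, P.map (Q.Z k) = expMeasure ν
  indep : iIndepFun (β := fun _ : ℕ ⊕ ℕ ⊕ ℕ ⊕ Unit => ℝ)
    (Sum.elim Q.X (Sum.elim Q.S (Sum.elim Q.Z (fun _ => Q.T₀)))) P

end UpdateDecideSystem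

/-- `π` is a stationary law of the system time in the queue with arrival rate `lam` and service
time distribution `σ`: if `T` has law `π`, `X` is exponential with rate `lam`, `S` has law `σ`, and
these are independent, then the system time `max (T - X) 0 + S` of the next update has law `π`. -/
def IsStationarySystemTimeLaw (lam : ℝ) (σ π : Measure ℝ) : Prop :=
  IsProbabilityMeasure π ∧
    (π.prod ((expMeasure lam).prod σ)).map
      (fun p : ℝ × ℝ × ℝ => max (p.1 - p.2.1) 0 + p.2.2) = π

/-! The departure time minus the accumulated service has two readings: it is the initial delay plus
the total idle time (`unservedTime_eq_sum`), and it is a running maximum of arrival times minus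
service sums (`unservedTime_succ`). The second reading and the strong law show that the idle time
per update tends to 1/λ - 1/μ. By memorylessness the next idle period has mean e^{-λT}/λ given the
system time T, and the idle periods centred in this way are orthogonal, so their averages tend to 0
(`ae_tendsto_average_sub_condMean`). Hence the averages of e^{-λT_k} tend to 1 - ρ from every
initial state, without any appeal to stationarity. The inter-departure time is an idle period plus a
service time, so e^{-νY} has conditional mean G_S(-ν)(1 - e^{-λT} ν/(λ+ν)), which is affine in
e^{-λT}; the same law of large numbers then shows that its averages tend to p_mis.

Almost surely, an update is missed exactly when no decision epoch falls between its departure and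
the next one. The decisions form a Poisson process independent of the queue. Given the queue, these
void events have probabilities e^{-νY_k} and are pairwise independent (`measureReal_noEpoch`), so
the centred indicators are orthogonal and (i) follows. In the stationary regime E[e^{-νY_k}] does
not depend on k, so dominated convergence identifies it with the limit of the averages; this is
(iii).

For (ii), existence is Loynes' construction: a service time plus the supremum of the random walk
with steps S - X. Uniqueness is a coupling: with common input, the systems started from x and from 0
coincide as soon as the running maximum of the latter exceeds x (`systemTime_withInitial`). -/

/-! ### Strong law for orthogonal sequences -/

/-- Strong law of large numbers for orthogonal random variables with bounded second moments. -/
theorem ae_tendsto_average_of_orthogonal {Ω : Type*} [MeasurableSpace Ω] {P : Measure Ω}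
    [IsProbabilityMeasure P] {D : ℕ → Ω → ℝ} (hm : ∀ k, Measurable (D k))
    (hL2 : ∀ k, Integrable (fun ω => D k ω ^ 2) P) {C : ℝ}
    (hC : ∀ k, ∫ ω, D k ω ^ 2 ∂P ≤ C)
    (horth : ∀ j k, j < k → ∫ ω, D j ω * D k ω ∂P = 0) :
    ∀ᵐ ω ∂P, Tendsto (fun n : ℕ => (∑ i ∈ Finset.range n, D i ω) / n) atTop (𝓝 0) := by
  have hC0 : 0 ≤ C := (integral_nonneg fun ω => sq_nonneg _).trans (hC 0)
  have hL2' : ∀ k, MemLp (D k) 2 P := fun k =>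
    (memLp_two_iff_integrable_sq (hm k).aestronglyMeasurable).2 (hL2 k)
  have hmul : ∀ j k, Integrable (fun ω => D j ω * D k ω) P := fun j k =>
    (hL2' j).integrable_mul (hL2' k)
  have horth' : ∀ j k, j ≠ k → ∫ ω, D j ω * D k ω ∂P = 0 := by
    intro j k hjk
    rcases lt_or_gt_of_ne hjk with h | h
    · exact horth j k h
    · simpa only [mul_comm] using horth k j h
  -- Along the squares m² the second moments of the averages are summable; `R` controls the sums
  -- between consecutive squares.
  set W : ℕ → Ω → ℝ := fun m ω => ∑ i ∈ Finset.range (m ^ 2), D i ω with hW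
  set R : ℕ → Ω → ℝ := fun m ω => ∑ i ∈ Finset.Ico (m ^ 2) ((m + 1) ^ 2), |D i ω| with hR
  have hWsq : ∀ m ω, W m ω ^ 2 =
      ∑ i ∈ Finset.range (m ^ 2), ∑ j ∈ Finset.range (m ^ 2), D i ω * D j ω := by
    intro m ω
    rw [hW, sq, Finset.sum_mul_sum]
  have hWint : ∀ m, Integrable (fun ω => W m ω ^ 2) P := by
    intro m
    simp only [hWsq]
    exact integrable_finsetSum _ fun i _ => integrable_finsetSum _ fun j _ => hmul i j
  have hWle : ∀ m, ∫ ω, W m ω ^ 2 ∂P ≤ C * m ^ 2 := by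
    intro m
    simp only [hWsq]
    rw [integral_finsetSum _ fun i _ => integrable_finsetSum _ fun j _ => hmul i j]
    calc ∑ i ∈ Finset.range (m ^ 2), ∫ ω, ∑ j ∈ Finset.range (m ^ 2), D i ω * D j ω ∂P
        ≤ ∑ i ∈ Finset.range (m ^ 2), C := by
          refine Finset.sum_le_sum fun i hi => ?_
          rw [integral_finsetSum _ fun j _ => hmul i j,
            Finset.sum_eq_single_of_mem i hi fun j _ hj => horth' i j hj.symm]
          simpa only [sq] using hC i
      _ = C * m ^ 2 := by simp [mul_comm]
  have hcard : ∀ m : ℕ, ((Finset.Ico (m ^ 2) ((m + 1) ^ 2)).card : ℝ) = 2 * m + 1 := by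
    intro m
    rw [Nat.card_Ico, show (m + 1) ^ 2 - m ^ 2 = 2 * m + 1 by
      rw [Nat.sub_eq_iff_eq_add (by gcongr; omega)]; ring]
    push_cast; ring
  have hRsq : ∀ m ω, R m ω ^ 2 ≤
      (2 * m + 1) * ∑ i ∈ Finset.Ico (m ^ 2) ((m + 1) ^ 2), D i ω ^ 2 := by
    intro m ω
    have := sq_sum_le_card_mul_sum_sq (s := Finset.Ico (m ^ 2) ((m + 1) ^ 2))
      (f := fun i => |D i ω|)
    simpa only [hcard, sq_abs] using this
  have hWm : ∀ m, Measurable (W m) := fun m => by fun_prop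
  have hRm : ∀ m, Measurable (R m) := fun m => by fun_prop
  have hRbd : ∀ m : ℕ, Integrable (fun ω => (2 * (m : ℝ) + 1) *
      ∑ i ∈ Finset.Ico (m ^ 2) ((m + 1) ^ 2), D i ω ^ 2) P := fun m =>
    (integrable_finsetSum _ fun i _ => hL2 i).const_mul _
  have hRint : ∀ m, Integrable (fun ω => R m ω ^ 2) P := by
    intro m
    refine (hRbd m).mono' ((hRm m).pow_const 2).aestronglyMeasurable ?_
    refine ae_of_all _ fun ω => ?_
    rw [Real.norm_of_nonneg (sq_nonneg _)]
    exact hRsq m ω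
  have hRle : ∀ m : ℕ, ∫ ω, R m ω ^ 2 ∂P ≤ (2 * m + 1) ^ 2 * C := by
    intro m
    refine (integral_mono (hRint m) (hRbd m) (hRsq m)).trans ?_
    rw [integral_const_mul, integral_finsetSum _ fun i _ => hL2 i]
    calc (2 * (m : ℝ) + 1) * ∑ i ∈ Finset.Ico (m ^ 2) ((m + 1) ^ 2), ∫ ω, D i ω ^ 2 ∂P
        ≤ (2 * (m : ℝ) + 1) * ∑ i ∈ Finset.Ico (m ^ 2) ((m + 1) ^ 2), C := by
          gcongr with i _
          exact hC i
      _ = (2 * m + 1) ^ 2 * C := by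
          rw [Finset.sum_const, nsmul_eq_mul, hcard]; ring
  -- Up to constants this dominates the squared averages for all n between m² and (m+1)². The shift
  -- m + 1 avoids division by zero; the expectations are O(1/m²), so the series of the `f m`
  -- converges almost surely and its terms tend to 0.
  set f : ℕ → Ω → ℝ := fun m ω => (W m ω ^ 2 + R m ω ^ 2) / ((m : ℝ) + 1) ^ 4 with hf
  have hf0 : ∀ m ω, 0 ≤ f m ω := fun m ω => by positivity
  have hfint : ∀ m, Integrable (f m) P := fun m => ((hWint m).add (hRint m)).div_const _
  have hfle : ∀ m : ℕ, ∫ ω, f m ω ∂P ≤ 5 * C * (1 / ((m : ℝ) + 1) ^ 2) := by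
    intro m
    have h1 : ∫ ω, f m ω ∂P = (∫ ω, W m ω ^ 2 ∂P + ∫ ω, R m ω ^ 2 ∂P) / ((m : ℝ) + 1) ^ 4 := by
      rw [hf, integral_div, integral_add (hWint m) (hRint m)]
    rw [h1, div_le_iff₀ (by positivity)]
    have h2 : 5 * C * (1 / ((m : ℝ) + 1) ^ 2) * ((m : ℝ) + 1) ^ 4 = 5 * C * ((m : ℝ) + 1) ^ 2 := by
      field_simp
    rw [h2]
    have h3 : (0 : ℝ) ≤ C * m := by positivity
    nlinarith [hWle m, hRle m]
  have hsum : Summable fun m : ℕ => 5 * C * (1 / ((m : ℝ) + 1) ^ 2) := by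
    refine Summable.mul_left _ ?_
    have := (summable_nat_add_iff 1).2 (Real.summable_one_div_nat_pow.2 (one_lt_two))
    simpa using this
  have hlin : ∫⁻ ω, ∑' m, ENNReal.ofReal (f m ω) ∂P ≠ ⊤ := by
    rw [lintegral_tsum fun m => (hfint m).1.aemeasurable.ennreal_ofReal]
    refine ne_top_of_le_ne_top hsum.tsum_ofReal_ne_top (ENNReal.tsum_le_tsum fun m => ?_)
    rw [← ofReal_integral_eq_lintegral_ofReal (hfint m) (ae_of_all _ (hf0 m))]
    exact ENNReal.ofReal_le_ofReal (hfle m)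
  have hae := ae_lt_top' (AEMeasurable.tsum
    fun m => (hfint m).1.aemeasurable.ennreal_ofReal) hlin
  filter_upwards [hae] with ω hω
  have hf_tend : Tendsto (fun m => f m ω) atTop (𝓝 0) := by
    have := ENNReal.tendsto_atTop_zero_of_tsum_ne_top hω.ne
    have h2 := (ENNReal.tendsto_toReal ENNReal.zero_ne_top).comp this
    simpa [Function.comp_def, ENNReal.toReal_ofReal (hf0 _ ω)] using h2
  have hsqrt : Tendsto Nat.sqrt atTop atTop :=
    tendsto_atTop.2 fun b => (eventually_ge_atTop (b * b)).mono fun n hn => Nat.le_sqrt.2 hn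
  -- 32 = 2 · 16: the 2 comes from (a+b)² ≤ 2(a²+b²), the 16 from (m+1)⁴ ≤ 16n² when m is the
  -- integer square root of n ≥ 1.
  have hlim : Tendsto (fun n : ℕ => √(32 * f n.sqrt ω)) atTop (𝓝 0) := by
    have := ((hf_tend.comp hsqrt).const_mul 32).sqrt
    simpa using this
  refine squeeze_zero_norm' ?_ hlim
  filter_upwards [eventually_ge_atTop 1] with n hn
  set m := n.sqrt with hmdef
  have hm1 : 1 ≤ m := Nat.le_sqrt.2 (by simpa using hn)
  have hmn : m ^ 2 ≤ n := by simpa [sq] using Nat.sqrt_le n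
  have hnm : n ≤ (m + 1) ^ 2 := by simpa [sq] using (Nat.lt_succ_sqrt n).le
  have habs : |∑ i ∈ Finset.range n, D i ω| ≤ |W m ω| + R m ω := by
    rw [← Finset.sum_range_add_sum_Ico _ hmn]
    refine (abs_add_le _ _).trans (add_le_add le_rfl ?_)
    refine (Finset.abs_sum_le_sum_abs _ _).trans ?_
    exact Finset.sum_le_sum_of_subset_of_nonneg
      (Finset.Ico_subset_Ico le_rfl hnm) fun i _ _ => abs_nonneg _
  rw [Real.norm_eq_abs, abs_div, Nat.abs_cast]
  refine Real.le_sqrt_of_sq_le ?_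
  have hn0 : (0 : ℝ) < n := by exact_mod_cast hn
  have hmn' : (m : ℝ) ^ 2 ≤ n := by exact_mod_cast hmn
  have hm1' : (1 : ℝ) ≤ m := by exact_mod_cast hm1
  rw [div_pow, div_le_iff₀ (by positivity)]
  have hfe : W m ω ^ 2 + R m ω ^ 2 = f m ω * ((m : ℝ) + 1) ^ 4 := by
    rw [hf]; field_simp
  have h4 : ((m : ℝ) + 1) ^ 4 ≤ 16 * (n : ℝ) ^ 2 := by
    have h5 : ((m : ℝ) + 1) ^ 2 ≤ 4 * n := by nlinarith
    calc ((m : ℝ) + 1) ^ 4 = (((m : ℝ) + 1) ^ 2) ^ 2 := by ring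
      _ ≤ (4 * (n : ℝ)) ^ 2 := by gcongr
      _ = 16 * (n : ℝ) ^ 2 := by ring
  calc |∑ i ∈ Finset.range n, D i ω| ^ 2 ≤ (|W m ω| + R m ω) ^ 2 := by gcongr
    _ ≤ 2 * (W m ω ^ 2 + R m ω ^ 2) := by nlinarith [sq_nonneg (|W m ω| - R m ω), sq_abs (W m ω)]
    _ = 2 * (f m ω * ((m : ℝ) + 1) ^ 4) := by rw [hfe]
    _ ≤ 2 * (f m ω * (16 * (n : ℝ) ^ 2)) := by gcongr
    _ = 32 * f m ω * (n : ℝ) ^ 2 := by ring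

/-! ### Independence of subfamilies and Fubini -/

/-- The family `f` with the entries outside of `A` replaced by `0`. -/
noncomputable def restrictedTuple {Ω ι : Type*} (f : ι → Ω → ℝ) (A : Set ι) (ω : Ω) : ι → ℝ :=
  A.indicator fun i => f i ω

theorem restrictedTuple_apply {Ω ι : Type*} (f : ι → Ω → ℝ) (A : Set ι) (ω : Ω) {i : ι}
    (hi : i ∈ A) : restrictedTuple f A ω i = f i ω :=
  Set.indicator_of_mem hi fun i => f i ω

theorem measurable_restrictedTuple {Ω ι : Type*} [MeasurableSpace Ω] {f : ι → Ω → ℝ}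
    (hf : ∀ i, Measurable (f i)) (A : Set ι) : Measurable (restrictedTuple f A) := by
  classical
  refine measurable_pi_iff.2 fun i => ?_
  by_cases hi : i ∈ A <;> simp [restrictedTuple, hi, hf i]

/-- Subfamilies of an independent family with disjoint index sets are independent. -/
theorem ProbabilityTheory.iIndepFun.indepFun_restrictedTuple {Ω ι : Type*} [MeasurableSpace Ω]
    {P : Measure Ω} {f : ι → Ω → ℝ} (h : iIndepFun f P) (hf : ∀ i, Measurable (f i))
    {A B : Set ι} (hAB : Disjoint A B) :
    IndepFun (restrictedTuple f A) (restrictedTuple f B) P := by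
  classical
  have key : ∀ A : Set ι, MeasurableSpace.comap (restrictedTuple f A) inferInstance ≤
      ⨆ i ∈ A, MeasurableSpace.comap (f i) inferInstance := by
    intro A
    rw [← measurable_iff_comap_le]
    refine @measurable_pi_iff _ _ _ (_) _ _ |>.2 fun i => ?_
    by_cases hi : i ∈ A
    · have : (fun ω => restrictedTuple f A ω i) = f i := by
        funext ω; simp [restrictedTuple, hi]
      rw [this, measurable_iff_comap_le]
      exact le_iSup₂_of_le i hi le_rfl
    · have : (fun ω => restrictedTuple f A ω i) = fun _ => 0 := by
        funext ω; simp [restrictedTuple, hi]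
      rw [this]
      exact measurable_const
  rw [IndepFun_iff_Indep]
  exact indep_of_indep_of_le_left (indep_of_indep_of_le_right
    (indep_iSup_of_disjoint (fun i => (hf i).comap_le) h.iIndep hAB) (key B)) (key A)

/-- Fubini's theorem for a function of two independent random variables. -/
theorem ProbabilityTheory.IndepFun.integral_comp_prodMk {Ω α β : Type*} [MeasurableSpace Ω]
    [MeasurableSpace α] [MeasurableSpace β] {P : Measure Ω} [IsProbabilityMeasure P]
    {U : Ω → α} {Y : Ω → β} (h : IndepFun U Y P) (hU : Measurable U) (hY : Measurable Y)
    {ψ : α × β → ℝ} (hψ : Measurable ψ) (hint : Integrable (fun ω => ψ (U ω, Y ω)) P) :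
    ∫ ω, ψ (U ω, Y ω) ∂P = ∫ ω, ∫ ω', ψ (U ω, Y ω') ∂P ∂P := by
  have hmap := (indepFun_iff_map_prod_eq_prod_map_map hU.aemeasurable hY.aemeasurable).1 h
  have h1 : ∫ ω, ψ (U ω, Y ω) ∂P = ∫ p, ψ p ∂((P.map U).prod (P.map Y)) := by
    rw [← hmap, integral_map (hU.prodMk hY).aemeasurable hψ.aestronglyMeasurable]
  have := Measure.isProbabilityMeasure_map hU.aemeasurable (μ := P)
  have := Measure.isProbabilityMeasure_map hY.aemeasurable (μ := P)
  rw [h1, integral_prod, integral_map hU.aemeasurable]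
  · refine integral_congr_ae (ae_of_all _ fun ω => ?_)
    simp only
    exact integral_map hY.aemeasurable
      (hψ.comp (measurable_prodMk_left (x := U ω))).aestronglyMeasurable
  · exact hψ.stronglyMeasurable.integral_prod_right'.aestronglyMeasurable
  · rw [← hmap, integrable_map_measure hψ.aestronglyMeasurable (hU.prodMk hY).aemeasurable]
    exact hint

/-- A function of two independent random variables is centred if it is centred given the first. -/
theorem ProbabilityTheory.IndepFun.integral_comp_prodMk_eq_zero {Ω α β : Type*}
    [MeasurableSpace Ω] [MeasurableSpace α] [MeasurableSpace β] {P : Measure Ω}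
    [IsProbabilityMeasure P] {U : Ω → α} {Y : Ω → β} (h : IndepFun U Y P) (hU : Measurable U)
    (hY : Measurable Y) {ψ : α × β → ℝ} (hψ : Measurable ψ)
    (h0 : ∀ᵐ ω ∂P, ∫ ω', ψ (U ω, Y ω') ∂P = 0) :
    ∫ ω, ψ (U ω, Y ω) ∂P = 0 := by
  by_cases hint : Integrable (fun ω => ψ (U ω, Y ω)) P
  · rw [h.integral_comp_prodMk hU hY hψ hint, integral_congr_ae h0, integral_zero]
  -- The Bochner integral of a non-integrable function is 0 by convention, so no integrability
  -- assumption is needed.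
  · exact integral_undef hint

/-- The strong law of large numbers, in terms of the common law of the random variables. -/
theorem ae_tendsto_average_of_map_eq {Ω : Type*} [MeasurableSpace Ω] {P : Measure Ω}
    {Y : ℕ → Ω → ℝ} {τ : Measure ℝ} (hm : ∀ k, Measurable (Y k)) (hind : iIndepFun Y P)
    (hlaw : ∀ k, P.map (Y k) = τ) (hint : Integrable (fun s : ℝ => s) τ) :
    ∀ᵐ ω ∂P, Tendsto (fun n : ℕ => (∑ i ∈ Finset.range n, Y i ω) / n) atTop
      (𝓝 (∫ s, s ∂τ)) := by
  have h0 : Integrable (Y 0) P := by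
    rw [← hlaw 0, integrable_map_measure (by fun_prop) (hm 0).aemeasurable] at hint
    exact hint
  rw [← hlaw 0, integral_map (hm 0).aemeasurable (by fun_prop)]
  exact strong_law_ae_real Y h0 (fun i j hij => hind.indepFun hij) fun i =>
    ⟨(hm i).aemeasurable, (hm 0).aemeasurable, by rw [hlaw, hlaw]⟩

/-! ### The exponential law -/

theorem integral_expMeasure {r : ℝ} (hr : 0 < r) (f : ℝ → ℝ) :
    ∫ x, f x ∂(expMeasure r) = ∫ x in Set.Ioi 0, r * Real.exp (-(r * x)) * f x := by
  have h : expMeasure r = volume.withDensity (exponentialPDF r) := rfl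
  have hmeas : Measurable (exponentialPDF r) :=
    (measurable_exponentialPDFReal r).ennreal_ofReal
  rw [h, integral_withDensity_eq_integral_toReal_smul hmeas
    (ae_of_all _ fun x => ENNReal.ofReal_lt_top), ← integral_Ici_eq_integral_Ioi,
    ← integral_indicator measurableSet_Ici]
  refine integral_congr_ae (ae_of_all _ fun x => ?_)
  by_cases hx : 0 ≤ x
  · simp only [exponentialPDF_of_nonneg hx, smul_eq_mul, Set.indicator, Set.mem_Ici, hx, if_true]
    rw [ENNReal.toReal_ofReal (by positivity)]
  · simp [exponentialPDF_of_neg (not_le.1 hx), Set.indicator, hx]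

theorem integrable_expMeasure_iff {r : ℝ} (hr : 0 < r) (f : ℝ → ℝ) :
    Integrable f (expMeasure r) ↔
      IntegrableOn (fun x => r * Real.exp (-(r * x)) * f x) (Set.Ioi 0) := by
  have h : expMeasure r = volume.withDensity (exponentialPDF r) := rfl
  have hmeas : Measurable (exponentialPDF r) :=
    (measurable_exponentialPDFReal r).ennreal_ofReal
  rw [h, integrable_withDensity_iff_integrable_smul' hmeas
    (ae_of_all _ fun x => ENNReal.ofReal_lt_top), ← integrableOn_Ici_iff_integrableOn_Ioi,
    ← integrable_indicator_iff measurableSet_Ici]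
  refine integrable_congr (ae_of_all _ fun x => ?_)
  by_cases hx : 0 ≤ x
  · simp only [exponentialPDF_of_nonneg hx, smul_eq_mul, Set.indicator, Set.mem_Ici, hx, if_true]
    rw [ENNReal.toReal_ofReal (by positivity)]
  · simp [exponentialPDF_of_neg (not_le.1 hx), Set.indicator, hx]

theorem integrable_sq_expMeasure {r : ℝ} (hr : 0 < r) :
    Integrable (fun x : ℝ => x ^ 2) (expMeasure r) := by
  rw [integrable_expMeasure_iff hr]
  have := integrableOn_rpow_mul_exp_neg_mul_rpow (s := 2) (p := 1) (b := r) (by norm_num)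
    (by norm_num) hr
  refine IntegrableOn.congr_fun (this.const_mul r) (fun x _ => ?_) measurableSet_Ioi
  simp only [Real.rpow_one, Real.rpow_two]
  ring_nf

theorem integrable_id_expMeasure {r : ℝ} (hr : 0 < r) :
    Integrable (fun x : ℝ => x) (expMeasure r) := by
  have := isProbabilityMeasure_expMeasure hr
  exact ((memLp_two_iff_integrable_sq (by fun_prop)).2 (integrable_sq_expMeasure hr)).integrable
    one_le_two

theorem integral_id_expMeasure {r : ℝ} (hr : 0 < r) : ∫ x, x ∂(expMeasure r) = 1 / r := by
  rw [integral_expMeasure hr]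
  have h := Real.integral_rpow_mul_exp_neg_mul_Ioi (a := 2) (r := r) (by norm_num) hr
  have h2 : ∫ x in Set.Ioi (0 : ℝ), r * Real.exp (-(r * x)) * x =
      r * ∫ x in Set.Ioi (0 : ℝ), x ^ ((2 : ℝ) - 1) * Real.exp (-(r * x)) := by
    rw [← integral_const_mul]
    refine setIntegral_congr_fun measurableSet_Ioi fun x _ => ?_
    rw [show (2 : ℝ) - 1 = 1 by norm_num, Real.rpow_one]
    ring
  rw [h2, h, Real.Gamma_two, Real.rpow_two]
  field_simp

theorem expMeasure_Ici {r : ℝ} (hr : 0 < r) {y : ℝ} (hy : 0 ≤ y) :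
    expMeasure r (Set.Ici y) = ENNReal.ofReal (Real.exp (-(r * y))) := by
  have := isProbabilityMeasure_expMeasure hr
  have hac : expMeasure r ≪ volume := withDensity_absolutelyContinuous _ _
  have h0 : expMeasure r {y} = 0 := hac (by simp)
  have h1 : (expMeasure r).real (Set.Iic y) = 1 - Real.exp (-(r * y)) := by
    rw [← cdf_eq_real, cdf_expMeasure_eq hr, if_pos hy]
  have h2 : expMeasure r (Set.Ici y) = expMeasure r (Set.Ioi y) :=
    measure_congr (Ioi_ae_eq_Ici' h0).symm
  rw [h2, ← Set.compl_Iic, ← ofReal_measureReal, probReal_compl_eq_one_sub measurableSet_Iic, h1]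
  ring_nf

theorem ae_nonneg_expMeasure {r : ℝ} (hr : 0 < r) : ∀ᵐ x ∂(expMeasure r), 0 ≤ x := by
  have := isProbabilityMeasure_expMeasure hr
  have h := expMeasure_Ici hr le_rfl
  rw [mul_zero, neg_zero, Real.exp_zero, ENNReal.ofReal_one] at h
  exact (mem_ae_iff_prob_eq_one measurableSet_Ici).2 h

/-- The memoryless property: the excess of an exponential random variable over `t` vanishes or is
again exponential. -/
theorem integral_excess_expMeasure {r : ℝ} (hr : 0 < r) {t : ℝ} (ht : 0 ≤ t) {f : ℝ → ℝ}
    (hf : f 0 = 0) :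
    ∫ x, f (max (x - t) 0) ∂(expMeasure r) =
      Real.exp (-(r * t)) * ∫ x, f x ∂(expMeasure r) := by
  rw [integral_expMeasure hr, integral_expMeasure hr, ← integral_const_mul,
    ← integral_indicator measurableSet_Ioi, ← integral_indicator measurableSet_Ioi]
  -- Translate by t: on x > t the density factors as e^{-rt} times the density at x - t, and on x ≤
  -- t the integrand vanishes because f 0 = 0.
  rw [← integral_sub_right_eq_self (Set.indicator (Set.Ioi 0) fun x : ℝ =>
    Real.exp (-(r * t)) * (r * Real.exp (-(r * x)) * f x)) t]
  refine integral_congr_ae (ae_of_all _ fun x => ?_)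
  by_cases hx : t < x
  · have h1 : 0 < x := ht.trans_lt hx
    have h2 : 0 < x - t := sub_pos.2 hx
    simp only [Set.indicator, Set.mem_Ioi, h1, h2, if_true, max_eq_left h2.le]
    rw [show -(r * x) = -(r * t) + -(r * (x - t)) by ring, Real.exp_add]
    ring
  · have h2 : x - t ≤ 0 := by linarith [not_lt.1 hx]
    simp [Set.indicator, hx, max_eq_right h2, hf]

/-- Used as the mean idle period that follows an update with system time t. -/
theorem integral_excess_id_expMeasure {r : ℝ} (hr : 0 < r) {t : ℝ} (ht : 0 ≤ t) :
    ∫ x, max (x - t) 0 ∂(expMeasure r) = Real.exp (-(r * t)) / r := by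
  rw [integral_excess_expMeasure hr ht (f := fun x => x) rfl, integral_id_expMeasure hr]
  ring

theorem integral_exp_neg_expMeasure {r ν : ℝ} (hr : 0 < r) (hν : 0 < ν) :
    ∫ x, Real.exp (-ν * x) ∂(expMeasure r) = r / (r + ν) := by
  rw [integral_expMeasure hr]
  have h : ∀ x : ℝ, r * Real.exp (-(r * x)) * Real.exp (-ν * x) =
      r * Real.exp (-(r + ν) * x) := fun x => by
    rw [mul_assoc, ← Real.exp_add]; ring_nf
  simp only [h]
  rw [integral_const_mul, integral_exp_mul_Ioi (by linarith)]
  have : r + ν ≠ 0 := by positivity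
  rw [mul_zero, Real.exp_zero, neg_div_neg_eq, mul_one_div]

/-- Memorylessness is applied to e^{-νx} - 1 rather than e^{-νx}, since the function must vanish at
0. -/
theorem integral_exp_neg_excess_expMeasure {r ν : ℝ} (hr : 0 < r) (hν : 0 < ν) {t : ℝ}
    (ht : 0 ≤ t) :
    ∫ x, Real.exp (-ν * max (x - t) 0) ∂(expMeasure r) =
      1 - Real.exp (-(r * t)) * (ν / (r + ν)) := by
  have := isProbabilityMeasure_expMeasure hr
  have hint : ∀ g : ℝ → ℝ, Measurable g → (∀ᵐ x ∂(expMeasure r), 0 ≤ g x) →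
      Integrable (fun x => Real.exp (-ν * g x)) (expMeasure r) := by
    intro g hg h0
    refine Integrable.of_bound (C := 1) (by fun_prop) ?_
    filter_upwards [h0] with x hx
    rw [Real.norm_of_nonneg (Real.exp_pos _).le, Real.exp_le_one_iff]
    nlinarith
  have h := integral_excess_expMeasure hr ht (f := fun x => Real.exp (-ν * x) - 1) (by simp)
  rw [integral_sub (hint (fun x => max (x - t) 0) (by fun_prop)
    (ae_of_all _ fun x => le_max_right _ _)) (integrable_const _),
    integral_sub (hint (fun x => x) measurable_id (ae_nonneg_expMeasure hr))
    (integrable_const _)] at h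
  simp only [integral_const, probReal_univ, smul_eq_mul, mul_one] at h
  rw [integral_exp_neg_expMeasure hr hν] at h
  have h2 : r + ν ≠ 0 := by positivity
  rw [show r / (r + ν) - 1 = -(ν / (r + ν)) by field_simp; ring] at h
  linarith

/-! ### Void probabilities of the Poisson process of decisions -/

/-- The epochs of a point process with given inter-epoch times. -/
noncomputable def epoch (z : ℕ → ℝ) (j : ℕ) : ℝ := ∑ i ∈ Finset.range (j + 1), z i

theorem epoch_succ (z : ℕ → ℝ) (j : ℕ) : epoch z (j + 1) = epoch z j + z (j + 1) :=
  Finset.sum_range_succ _ _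

theorem measurable_epoch (j : ℕ) : Measurable fun z : ℕ → ℝ => epoch z j := by
  unfold epoch; fun_prop

theorem epoch_mono {z : ℕ → ℝ} (hz : ∀ i, 0 ≤ z i) : Monotone (epoch z) :=
  monotone_nat_of_le_succ fun j => by rw [epoch_succ]; linarith [hz (j + 1)]

section Renewal

variable {Ω : Type*} [MeasurableSpace Ω] {P : Measure Ω} {Z : ℕ → Ω → ℝ} {r : ℝ}

theorem ae_epoch_tendsto_atTop (hr : 0 < r) (hm : ∀ k, Measurable (Z k))
    (hind : iIndepFun Z P) (hlaw : ∀ k, P.map (Z k) = expMeasure r) :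
    ∀ᵐ ω ∂P, Tendsto (epoch fun i => Z i ω) atTop atTop := by
  have hslln := ae_tendsto_average_of_map_eq hm hind hlaw (integrable_id_expMeasure hr)
  filter_upwards [hslln] with ω hω
  rw [integral_id_expMeasure hr] at hω
  have h1 := (hω.pos_mul_atTop (by positivity) tendsto_natCast_atTop_atTop).congr'
    ((eventually_ge_atTop 1).mono fun n hn => div_mul_cancel₀ _ (by positivity))
  exact h1.comp (tendsto_add_atTop_nat 1)

/-- The `j`-th epoch is the first one that is not less than `c`, the previous ones are not in `B`,
and the `j`-th epoch is not less than `d`. -/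
def firstEpochEvent (B : Set ℝ) (c d : ℝ) (j : ℕ) : Set (ℕ → ℝ) :=
  {z | (∀ i < j, epoch z i ∉ B ∧ epoch z i < c) ∧ d ≤ epoch z j}

theorem measurableSet_firstEpochEvent {B : Set ℝ} (hB : MeasurableSet B) (c d : ℝ) (j : ℕ) :
    MeasurableSet (firstEpochEvent B c d j) := by
  have h1 : MeasurableSet {z : ℕ → ℝ | ∀ i < j, epoch z i ∉ B ∧ epoch z i < c} := by
    simp only [Set.ofPred_forall]
    refine MeasurableSet.iInter fun i => MeasurableSet.iInter fun _ => ?_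
    exact ((measurable_epoch i) hB).compl.inter (measurableSet_lt (measurable_epoch i) (by fun_prop))
  exact h1.inter (measurableSet_le (by fun_prop) (measurable_epoch j))

/-- Since the epochs increase to infinity, there is a first one at or after c. Later epochs are
larger, so avoiding [c, d) means that this one is already at least d; earlier epochs only have to
avoid B. -/
theorem noEpoch_iff_exists_firstEpochEvent {z : ℕ → ℝ} (hz : ∀ i, 0 ≤ z i)
    (htop : Tendsto (epoch z) atTop atTop) {B : Set ℝ} {c d : ℝ} (hB : B ⊆ Set.Iio c)
    (hcd : c ≤ d) :
    (∀ j, epoch z j ∉ B ∧ epoch z j ∉ Set.Ico c d) ↔ ∃ j, z ∈ firstEpochEvent B c d j := by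
  classical
  constructor
  · intro h
    have hex : ∃ j, c ≤ epoch z j := (htop.eventually_ge_atTop c).exists
    refine ⟨Nat.find hex, fun i hi => ⟨(h i).1, not_le.1 (Nat.find_min hex hi)⟩, ?_⟩
    by_contra hlt
    exact (h _).2 ⟨Nat.find_spec hex, not_le.1 hlt⟩
  · rintro ⟨j, hj, hd⟩ i
    rcases lt_or_ge i j with hi | hi
    · exact ⟨(hj i hi).1, fun hmem => absurd hmem.1 (not_le.2 (hj i hi).2)⟩
    · have hdi : d ≤ epoch z i := hd.trans (epoch_mono hz hi)
      exact ⟨fun hmem => absurd (hB hmem) (not_lt.2 (hcd.trans hdi)),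
        fun hmem => absurd hmem.2 (not_lt.2 hdi)⟩

theorem firstEpochEvent_disjoint {B : Set ℝ} {c d : ℝ} (hcd : c ≤ d) :
    Pairwise (Function.onFun Disjoint (firstEpochEvent B c d)) := by
  have key : ∀ i j, i < j → Disjoint (firstEpochEvent B c d i) (firstEpochEvent B c d j) := by
    intro i j hij
    refine Set.disjoint_left.2 fun z hi hj => ?_
    exact absurd (hj.1 i hij).2 (not_lt.2 (hcd.trans hi.2))
  intro i j hij
  rcases lt_or_gt_of_ne hij with h | h
  · exact key i j h
  · exact (key j i h).symm

theorem measure_noEpoch_eq_tsum (hr : 0 < r) (hm : ∀ k, Measurable (Z k))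
    (hind : iIndepFun Z P) (hlaw : ∀ k, P.map (Z k) = expMeasure r)
    {B : Set ℝ} (hBm : MeasurableSet B) {c d : ℝ} (hB : B ⊆ Set.Iio c) (hcd : c ≤ d) :
    P {ω | ∀ j, epoch (fun i => Z i ω) j ∉ B ∧ epoch (fun i => Z i ω) j ∉ Set.Ico c d} =
      ∑' j, P {ω | (fun i => Z i ω) ∈ firstEpochEvent B c d j} := by
  have hZ : Measurable fun ω i => Z i ω := measurable_pi_iff.2 hm
  rw [← measure_iUnion]
  · refine measure_congr ?_
    have hnn : ∀ᵐ ω ∂P, ∀ i, 0 ≤ Z i ω := ae_all_iff.2 fun i =>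
      ae_of_ae_map (hm i).aemeasurable (by rw [hlaw]; exact ae_nonneg_expMeasure hr)
    filter_upwards [hnn, ae_epoch_tendsto_atTop hr hm hind hlaw] with ω h1 h2
    have := noEpoch_iff_exists_firstEpochEvent h1 h2 hB hcd
    refine propext ?_
    change (∀ j, _) ↔ ω ∈ ⋃ j, _
    rw [this, Set.mem_iUnion]
    rfl
  · intro i j hij
    exact (firstEpochEvent_disjoint (B := B) hcd hij).preimage _
  · exact fun j => hZ (measurableSet_firstEpochEvent hBm c d j)

/-- Condition on the gaps before the j-th: the last requirement becomes a lower bound on the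
independent gap `Z j`, and replacing c by d in this bound multiplies the exponential tail by a
factor that does not depend on j. -/
theorem measure_firstEpochEvent [IsProbabilityMeasure P] (hr : 0 < r) (hm : ∀ k, Measurable (Z k))
    (hind : iIndepFun Z P) (hlaw : ∀ k, P.map (Z k) = expMeasure r)
    {B : Set ℝ} (hBm : MeasurableSet B) {c d : ℝ} (hc : 0 ≤ c) (hcd : c ≤ d) (j : ℕ) :
    P {ω | (fun i => Z i ω) ∈ firstEpochEvent B c d j} =
      ENNReal.ofReal (Real.exp (-(r * (d - c)))) *
        P {ω | (fun i => Z i ω) ∈ firstEpochEvent B c c j} := by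
  classical
  have hexp := isProbabilityMeasure_expMeasure hr
  have hj : Measurable fun u : ℕ → ℝ => u j := measurable_pi_apply j
  set U : Ω → ℕ → ℝ := restrictedTuple Z (Set.Iio j) with hU
  have hUm : Measurable U := measurable_restrictedTuple hm _
  have hUZ : IndepFun U (Z j) P := by
    have h := hind.indepFun_restrictedTuple hm
      (show Disjoint (Set.Iio j) {j} from Set.disjoint_singleton_right.2 (lt_irrefl j))
    have h2 := h.comp (φ := id) (ψ := fun u : ℕ → ℝ => u j) measurable_id hj
    have h3 : (fun u : ℕ → ℝ => u j) ∘ restrictedTuple Z {j} = Z j := by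
      funext ω; simp [restrictedTuple]
    rwa [h3] at h2
  have hmap := (indepFun_iff_map_prod_eq_prod_map_map hUm.aemeasurable (hm j).aemeasurable).1 hUZ
  set G : Set (ℕ → ℝ) := {u | ∀ i < j, epoch u i ∉ B ∧ epoch u i < c} with hG
  set s : (ℕ → ℝ) → ℝ := fun u => ∑ i ∈ Finset.range j, u i with hs
  have hsm : Measurable s := by fun_prop
  have hGm : MeasurableSet G := by
    rw [hG]
    simp only [Set.ofPred_forall]
    refine MeasurableSet.iInter fun i => MeasurableSet.iInter fun _ => ?_
    exact ((measurable_epoch i) hBm).compl.inter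
      (measurableSet_lt (measurable_epoch i) (by fun_prop))
  have hEm : ∀ y : ℝ, MeasurableSet {p : (ℕ → ℝ) × ℝ | p.1 ∈ G ∧ y - s p.1 ≤ p.2} := fun y =>
    (measurable_fst hGm).inter
      (measurableSet_le (measurable_const.sub (hsm.comp measurable_fst)) measurable_snd)
  have hrepr : ∀ y : ℝ, P {ω | (fun i => Z i ω) ∈ firstEpochEvent B c y j} =
      ∫⁻ u in G, expMeasure r (Set.Ici (y - s u)) ∂(P.map U) := by
    intro y
    have h1 : {ω | (fun i => Z i ω) ∈ firstEpochEvent B c y j} =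
        (fun ω => (U ω, Z j ω)) ⁻¹' {p : (ℕ → ℝ) × ℝ | p.1 ∈ G ∧ y - s p.1 ≤ p.2} := by
      ext ω
      have hUi : ∀ i < j, U ω i = Z i ω := fun i hi => by simp [hU, restrictedTuple, hi]
      have he : ∀ i < j, epoch (U ω) i = epoch (fun i => Z i ω) i := fun i hi =>
        Finset.sum_congr rfl fun l hl => hUi l (by have := Finset.mem_range.1 hl; omega)
      have hse : s (U ω) = ∑ i ∈ Finset.range j, Z i ω :=
        Finset.sum_congr rfl fun l hl => hUi l (Finset.mem_range.1 hl)
      simp only [firstEpochEvent, Set.mem_ofPred_eq, Set.mem_preimage, hG]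
      refine and_congr (forall₂_congr fun i hi => by rw [he i hi]) ?_
      rw [hse, epoch, Finset.sum_range_succ, sub_le_iff_le_add, add_comm]
    rw [h1, ← Measure.map_apply (hUm.prodMk (hm j)) (hEm y), hmap, hlaw,
      Measure.prod_apply (hEm y), ← lintegral_indicator hGm]
    refine lintegral_congr fun u => ?_
    by_cases hu : u ∈ G
    · simp only [hu, Set.indicator_of_mem, Set.preimage_ofPred_eq, true_and]
      rfl
    · simp [hu]
  rw [hrepr, hrepr, ← lintegral_const_mul' _ _ ENNReal.ofReal_ne_top]
  refine setLIntegral_congr_fun hGm fun u hu => ?_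
  -- This makes the bounds c - s and d - s nonnegative, so that the exponential tail formula applies
  -- to both. For j = 0 the sum is empty and 0 ≤ c is needed.
  have hsc : s u ≤ c := by
    rcases j with _ | j
    · simpa [hs] using hc
    · exact (hu j (Nat.lt_succ_self j)).2.le
  rw [expMeasure_Ici hr (by linarith), expMeasure_Ici hr (by linarith),
    ← ENNReal.ofReal_mul (Real.exp_pos _).le, ← Real.exp_add]
  ring_nf

/-- Independent increments of the Poisson process: the number of epochs in `[c, d)` is `0` with
probability `exp (-r (d - c))`, independently of what happens before `c`. -/
theorem measureReal_noEpoch [IsProbabilityMeasure P] (hr : 0 < r) (hm : ∀ k, Measurable (Z k))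
    (hind : iIndepFun Z P) (hlaw : ∀ k, P.map (Z k) = expMeasure r)
    {B : Set ℝ} (hBm : MeasurableSet B) {c d : ℝ} (hB : B ⊆ Set.Iio c) (hc : 0 ≤ c)
    (hcd : c ≤ d) :
    P.real {ω | ∀ j, epoch (fun i => Z i ω) j ∉ B ∧ epoch (fun i => Z i ω) j ∉ Set.Ico c d} =
      Real.exp (-(r * (d - c))) * P.real {ω | ∀ j, epoch (fun i => Z i ω) j ∉ B} := by
  have h1 := measure_noEpoch_eq_tsum hr hm hind hlaw hBm hB hcd
  -- With d = c the interval is empty, so the same decomposition computes the probability of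
  -- avoiding B alone.
  have h2 := measure_noEpoch_eq_tsum hr hm hind hlaw hBm hB le_rfl
  simp only [Set.Ico_self, Set.mem_empty_iff_false, not_false_eq_true, and_true] at h2
  simp only [measure_firstEpochEvent hr hm hind hlaw hBm hc hcd] at h1
  rw [ENNReal.tsum_mul_left, ← h2] at h1
  rw [measureReal_def, h1, ENNReal.toReal_mul, ENNReal.toReal_ofReal (Real.exp_pos _).le,
    measureReal_def]

theorem measureReal_noEpoch_Ico [IsProbabilityMeasure P] (hr : 0 < r) (hm : ∀ k, Measurable (Z k))
    (hind : iIndepFun Z P) (hlaw : ∀ k, P.map (Z k) = expMeasure r) {c d : ℝ} (hc : 0 ≤ c)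
    (hcd : c ≤ d) :
    P.real {ω | ∀ j, epoch (fun i => Z i ω) j ∉ Set.Ico c d} = Real.exp (-(r * (d - c))) := by
  have := measureReal_noEpoch hr hm hind hlaw MeasurableSet.empty (Set.empty_subset _) hc hcd
  simpa using this

end Renewal

/-! ### Growth of running maxima -/

/-- If `a k / (k + 1)` tends to a nonnegative limit, then so does the running maximum of `a`,
divided by `k`. -/
theorem tendsto_runningMax_div {a V : ℕ → ℝ} {c : ℝ} (hc : 0 ≤ c)
    (ha : Tendsto (fun k : ℕ => a k / ((k : ℝ) + 1)) atTop (𝓝 c))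
    (hV : ∀ k, V (k + 1) = max (a k) (V k)) :
    Tendsto (fun k : ℕ => V k / (k : ℝ)) atTop (𝓝 c) := by
  refine tendsto_order.2 ⟨fun b hb => ?_, fun b hb => ?_⟩
  · rw [← eventually_map (m := fun k : ℕ => k) (P := fun k : ℕ => b < V k / (k : ℝ)), map_id',
      ← Filter.map_add_atTop_eq_nat 1, eventually_map]
    filter_upwards [(tendsto_order.1 ha).1 b hb] with k hk
    push_cast
    refine hk.trans_le ?_
    rw [hV]
    gcongr
    exact le_max_left _ _
  -- One ε absorbs the error in the limit of a, the other absorbs the contribution of the maximum up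
  -- to time K.
  · set ε := (b - c) / 2 with hε
    have hε0 : 0 < ε := by rw [hε]; linarith
    obtain ⟨K, hK⟩ := eventually_atTop.1 ((tendsto_order.1 ha).2 (c + ε) (by linarith))
    -- Nonnegativity of c makes the right-hand side increasing in n, so the old maximum still
    -- satisfies the bound at the next step.
    have hbound : ∀ n, K ≤ n → V n ≤ |V K| + (c + ε) * n := by
      intro n hn
      induction n, hn using Nat.le_induction with
      | base =>
        have : 0 ≤ (c + ε) * K := by positivity
        linarith [le_abs_self (V K)]
      | succ n hn ih =>
        rw [hV]
        push_cast
        refine max_le ?_ ?_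
        · have h1 := (div_lt_iff₀ (by positivity)).1 (hK n hn)
          linarith [abs_nonneg (V K)]
        · linarith
    have hz : Tendsto (fun n : ℕ => |V K| / (n : ℝ)) atTop (𝓝 0) :=
      tendsto_const_div_atTop_nhds_zero_nat _
    filter_upwards [eventually_ge_atTop K, eventually_ge_atTop 1,
      (tendsto_order.1 hz).2 ε hε0] with n hnK hn1 hnε
    have hn0 : (0 : ℝ) < n := by exact_mod_cast hn1
    rw [div_lt_iff₀ hn0] at hnε ⊢
    have : b = c + ε + ε := by rw [hε]; ring
    rw [this]
    linarith [hbound n hnK]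

/-! ### The queue recursion as a function of the data -/

namespace UpdateDecideSystem

variable {Ω : Type*} (Q : UpdateDecideSystem Ω)

/-- The family of all the random data of the system. -/
def data : ℕ ⊕ ℕ ⊕ ℕ ⊕ Unit → Ω → ℝ :=
  Sum.elim Q.X (Sum.elim Q.S (Sum.elim Q.Z (fun _ => Q.T₀)))

/-- The system whose data are the coordinates. -/
def canonical : UpdateDecideSystem (ℕ ⊕ ℕ ⊕ ℕ ⊕ Unit → ℝ) where
  T₀ u := u (.inr (.inr (.inr ())))
  X k u := u (.inl k)
  S k u := u (.inr (.inl k))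
  Z k u := u (.inr (.inr (.inl k)))

/-- The time that update `k` spends in the system. -/
noncomputable def systemTime (k : ℕ) (ω : Ω) : ℝ := Q.departure k ω - Q.arrival k ω

theorem arrival_succ (k : ℕ) (ω : Ω) : Q.arrival (k + 1) ω = Q.arrival k ω + Q.X k ω :=
  Finset.sum_range_succ _ _

theorem departure_succ (k : ℕ) (ω : Ω) :
    Q.departure (k + 1) ω = max (Q.arrival (k + 1) ω) (Q.departure k ω) + Q.S k ω := rfl

theorem systemTime_zero (ω : Ω) : Q.systemTime 0 ω = Q.T₀ ω := by
  simp [systemTime, arrival, departure]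

theorem systemTime_succ (k : ℕ) (ω : Ω) :
    Q.systemTime (k + 1) ω = max (Q.systemTime k ω - Q.X k ω) 0 + Q.S k ω := by
  have h : max (Q.arrival k ω + Q.X k ω) (Q.departure k ω) =
      max (Q.departure k ω - Q.arrival k ω - Q.X k ω) 0 + (Q.arrival k ω + Q.X k ω) := by
    rw [max_add, max_comm]
    ring_nf
  rw [systemTime, systemTime, departure_succ, arrival_succ, h]
  ring

/-- After a departure the server idles until the next arrival, if that is still to come, and then
serves. -/
theorem interDeparture_eq (k : ℕ) (ω : Ω) :
    Q.interDeparture k ω = max (Q.X k ω - Q.systemTime k ω) 0 + Q.S k ω := by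
  have h : max (Q.arrival k ω + Q.X k ω) (Q.departure k ω) =
      max (Q.X k ω - (Q.departure k ω - Q.arrival k ω)) 0 + Q.departure k ω := by
    rw [max_add]
    ring_nf
  rw [interDeparture, systemTime, departure_succ, arrival_succ, h]
  ring

/-- Causality. Comparing a system with `canonical` evaluated at a restricted tuple, it exhibits
departure times as functions of the part of the data that they depend on. -/
theorem departure_congr {Ω' : Type*} {Q : UpdateDecideSystem Ω} {Q' : UpdateDecideSystem Ω'}
    {ω : Ω} {ω' : Ω'} {k : ℕ} (hT : Q.T₀ ω = Q'.T₀ ω') (hX : ∀ i < k, Q.X i ω = Q'.X i ω')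
    (hS : ∀ i < k, Q.S i ω = Q'.S i ω') :
    Q.arrival k ω = Q'.arrival k ω' ∧ Q.departure k ω = Q'.departure k ω' := by
  induction k with
  | zero => exact ⟨rfl, hT⟩
  | succ k ih =>
    obtain ⟨h1, h2⟩ := ih (fun i hi => hX i (by omega)) (fun i hi => hS i (by omega))
    have h3 : Q.arrival (k + 1) ω = Q'.arrival (k + 1) ω' := by
      rw [arrival_succ, arrival_succ, h1, hX k (Nat.lt_succ_self k)]
    exact ⟨h3, by rw [departure_succ, departure_succ, h2, h3, hS k (Nat.lt_succ_self k)]⟩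

section Measurability

variable [MeasurableSpace Ω]

variable {Q} in
theorem measurable_arrival (hX : ∀ k, Measurable (Q.X k)) (k : ℕ) : Measurable (Q.arrival k) := by
  unfold arrival; fun_prop

variable {Q} in
theorem measurable_departure (hT : Measurable Q.T₀) (hX : ∀ k, Measurable (Q.X k))
    (hS : ∀ k, Measurable (Q.S k)) (k : ℕ) : Measurable (Q.departure k) := by
  induction k with
  | zero => exact hT
  | succ k ih => exact ((measurable_arrival hX (k + 1)).max ih).add (hS k)

theorem measurable_canonical_departure (k : ℕ) : Measurable (canonical.departure k) :=
  measurable_departure (measurable_pi_apply _) (fun _ => measurable_pi_apply _)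
    (fun _ => measurable_pi_apply _) k

theorem measurable_canonical_systemTime (k : ℕ) : Measurable (canonical.systemTime k) :=
  (measurable_canonical_departure k).sub (measurable_arrival (fun _ => measurable_pi_apply _) k)

end Measurability

/-- The indices of the data that determine the system up to the departure of update `k`. -/
def pastIndices (k : ℕ) : Set (ℕ ⊕ ℕ ⊕ ℕ ⊕ Unit) :=
  {i | Sum.elim (· < k) (Sum.elim (· < k) (Sum.elim (fun _ => False) fun _ => True)) i}

/-- The indices of the data other than the inter-decision times. -/
def queueIndices : Set (ℕ ⊕ ℕ ⊕ ℕ ⊕ Unit) :=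
  {i | Sum.elim (fun _ => True) (Sum.elim (fun _ => True)
    (Sum.elim (fun _ => False) fun _ => True)) i}

/-- The data that determine the system up to the departure of update `k`. -/
noncomputable def past (k : ℕ) : Ω → ℕ ⊕ ℕ ⊕ ℕ ⊕ Unit → ℝ :=
  restrictedTuple Q.data (pastIndices k)

/-- The data other than the inter-decision times. -/
noncomputable def queueData : Ω → ℕ ⊕ ℕ ⊕ ℕ ⊕ Unit → ℝ := restrictedTuple Q.data queueIndices

section Past

variable {Q} {j k : ℕ} (ω : Ω)

theorem past_T₀ : canonical.T₀ (Q.past k ω) = Q.T₀ ω :=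
  restrictedTuple_apply Q.data (pastIndices k) ω (i := .inr (.inr (.inr ()))) trivial

theorem past_X (h : j < k) : canonical.X j (Q.past k ω) = Q.X j ω :=
  restrictedTuple_apply Q.data (pastIndices k) ω (i := .inl j) h

theorem past_S (h : j < k) : canonical.S j (Q.past k ω) = Q.S j ω :=
  restrictedTuple_apply Q.data (pastIndices k) ω (i := .inr (.inl j)) h

theorem systemTime_past (h : j ≤ k) : canonical.systemTime j (Q.past k ω) = Q.systemTime j ω := by
  obtain ⟨h1, h2⟩ := departure_congr (Q := canonical) (Q' := Q) (k := j) (past_T₀ (k := k) ω)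
    (fun i hi => past_X ω (hi.trans_le h)) (fun i hi => past_S ω (hi.trans_le h))
  rw [systemTime, systemTime, h1, h2]

theorem departure_queueData : canonical.departure k (Q.queueData ω) = Q.departure k ω := by
  refine (departure_congr (Q := canonical) (Q' := Q) ?_ (fun i _ => ?_) (fun i _ => ?_)).2
  · exact restrictedTuple_apply Q.data queueIndices ω (i := .inr (.inr (.inr ()))) trivial
  · exact restrictedTuple_apply Q.data queueIndices ω (i := .inl i) trivial
  · exact restrictedTuple_apply Q.data queueIndices ω (i := .inr (.inl i)) trivial

end Past

end UpdateDecideSystem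

/-! ### Independence structure of the system -/

namespace UpdateDecideSystem

namespace IsMG1M

variable {Ω : Type*} {Q : UpdateDecideSystem Ω} [MeasurableSpace Ω] {P : Measure Ω}
  {lam ν : ℝ} {σ : Measure ℝ}

theorem measurable_data (hQ : Q.IsMG1M P lam σ ν) (i) : Measurable (Q.data i) := by
  rcases i with i | i | i | i
  exacts [hQ.measurable_X i, hQ.measurable_S i, hQ.measurable_Z i, hQ.measurable_T₀]

theorem measurable_past (hQ : Q.IsMG1M P lam σ ν) (k : ℕ) : Measurable (Q.past k) :=
  measurable_restrictedTuple hQ.measurable_data _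

theorem measurable_queueData (hQ : Q.IsMG1M P lam σ ν) : Measurable Q.queueData :=
  measurable_restrictedTuple hQ.measurable_data _

theorem measurable_departure (hQ : Q.IsMG1M P lam σ ν) (k : ℕ) : Measurable (Q.departure k) :=
  UpdateDecideSystem.measurable_departure hQ.measurable_T₀ hQ.measurable_X hQ.measurable_S k

theorem measurable_systemTime (hQ : Q.IsMG1M P lam σ ν) (k : ℕ) : Measurable (Q.systemTime k) :=
  (hQ.measurable_departure k).sub (measurable_arrival hQ.measurable_X k)

theorem measurable_interDeparture (hQ : Q.IsMG1M P lam σ ν) (k : ℕ) :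
    Measurable (Q.interDeparture k) :=
  (hQ.measurable_departure (k + 1)).sub (hQ.measurable_departure k)

theorem iIndepFun_X (hQ : Q.IsMG1M P lam σ ν) : iIndepFun Q.X P :=
  hQ.indep.precomp (g := fun k => .inl k) Sum.inl_injective

theorem iIndepFun_S (hQ : Q.IsMG1M P lam σ ν) : iIndepFun Q.S P :=
  hQ.indep.precomp (g := fun k => .inr (.inl k)) (Sum.inr_injective.comp Sum.inl_injective)

theorem iIndepFun_Z (hQ : Q.IsMG1M P lam σ ν) : iIndepFun Q.Z P :=
  hQ.indep.precomp (g := fun k => .inr (.inr (.inl k)))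
    (Sum.inr_injective.comp (Sum.inr_injective.comp Sum.inl_injective))

theorem map_X_S [IsProbabilityMeasure P] (hQ : Q.IsMG1M P lam σ ν) (k : ℕ) :
    P.map (fun ω => (Q.X k ω, Q.S k ω)) = (expMeasure lam).prod σ := by
  have h : IndepFun (Q.X k) (Q.S k) P :=
    hQ.indep.indepFun (i := .inl k) (j := .inr (.inl k)) (by simp)
  rw [(indepFun_iff_map_prod_eq_prod_map_map (hQ.measurable_X k).aemeasurable
    (hQ.measurable_S k).aemeasurable).1 h, hQ.law_X, hQ.law_S]

theorem measurable_X_S (hQ : Q.IsMG1M P lam σ ν) (k : ℕ) :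
    Measurable fun ω => (Q.X k ω, Q.S k ω) := (hQ.measurable_X k).prodMk (hQ.measurable_S k)

/-- The past of update k involves only inter-arrival and service times with index below k, besides
the initial state. -/
theorem indepFun_past_X_S (hQ : Q.IsMG1M P lam σ ν) (k : ℕ) :
    IndepFun (Q.past k) (fun ω => (Q.X k ω, Q.S k ω)) P := by
  have hd : Disjoint (pastIndices k) {.inl k, .inr (.inl k)} := by
    refine Set.disjoint_right.2 ?_
    rintro i (rfl | rfl) hi
    · exact lt_irrefl k hi
    · exact lt_irrefl k hi
  have h := hQ.indep.indepFun_restrictedTuple hQ.measurable_data hd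
  have hm : Measurable fun u : ℕ ⊕ ℕ ⊕ ℕ ⊕ Unit → ℝ => (u (.inl k), u (.inr (.inl k))) :=
    (measurable_pi_apply _).prodMk (measurable_pi_apply _)
  have h2 := h.comp measurable_id hm
  have h3 : (fun u : ℕ ⊕ ℕ ⊕ ℕ ⊕ Unit → ℝ => (u (.inl k), u (.inr (.inl k)))) ∘
      restrictedTuple Q.data {.inl k, .inr (.inl k)} = fun ω => (Q.X k ω, Q.S k ω) := by
    funext ω
    refine Prod.ext ?_ ?_
    · exact restrictedTuple_apply Q.data {.inl k, .inr (.inl k)} ω (i := .inl k) (by simp)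
    · exact restrictedTuple_apply Q.data {.inl k, .inr (.inl k)} ω (i := .inr (.inl k)) (by simp)
  exact h3 ▸ h2

theorem indepFun_systemTime_X_S (hQ : Q.IsMG1M P lam σ ν) (k : ℕ) :
    IndepFun (Q.systemTime k) (fun ω => (Q.X k ω, Q.S k ω)) P := by
  have h := (hQ.indepFun_past_X_S k).comp (measurable_canonical_systemTime k) measurable_id
  have h2 : canonical.systemTime k ∘ Q.past k = Q.systemTime k :=
    funext fun ω => systemTime_past ω le_rfl
  exact h2 ▸ h

theorem indepFun_queueData_Z (hQ : Q.IsMG1M P lam σ ν) :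
    IndepFun Q.queueData (fun ω i => Q.Z i ω) P := by
  have h := hQ.indep.indepFun_restrictedTuple hQ.measurable_data
    (disjoint_compl_right (a := queueIndices))
  have hm : Measurable fun (u : ℕ ⊕ ℕ ⊕ ℕ ⊕ Unit → ℝ) (i : ℕ) => u (.inr (.inr (.inl i))) :=
    measurable_pi_iff.2 fun i => measurable_pi_apply _
  have h2 := h.comp measurable_id hm
  have h3 : (fun (u : ℕ ⊕ ℕ ⊕ ℕ ⊕ Unit → ℝ) (i : ℕ) => u (.inr (.inr (.inl i)))) ∘
      restrictedTuple Q.data queueIndicesᶜ = fun ω i => Q.Z i ω := by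
    funext ω i
    exact restrictedTuple_apply Q.data queueIndicesᶜ ω (i := .inr (.inr (.inl i))) id
  exact h3 ▸ h2

theorem ae_nonneg (hQ : Q.IsMG1M P lam σ ν) (hlam : 0 < lam) (hν : 0 < ν)
    (hσ : ∀ᵐ s ∂σ, 0 ≤ s) :
    ∀ᵐ ω ∂P, 0 ≤ Q.T₀ ω ∧ (∀ k, 0 ≤ Q.X k ω) ∧ (∀ k, 0 ≤ Q.S k ω) ∧ ∀ k, 0 ≤ Q.Z k ω := by
  have hX : ∀ᵐ ω ∂P, ∀ k, 0 ≤ Q.X k ω := ae_all_iff.2 fun k =>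
    ae_of_ae_map (hQ.measurable_X k).aemeasurable (by
      rw [hQ.law_X]; exact ae_nonneg_expMeasure hlam)
  have hS : ∀ᵐ ω ∂P, ∀ k, 0 ≤ Q.S k ω := ae_all_iff.2 fun k =>
    ae_of_ae_map (hQ.measurable_S k).aemeasurable (by rw [hQ.law_S]; exact hσ)
  have hZ : ∀ᵐ ω ∂P, ∀ k, 0 ≤ Q.Z k ω := ae_all_iff.2 fun k =>
    ae_of_ae_map (hQ.measurable_Z k).aemeasurable (by
      rw [hQ.law_Z]; exact ae_nonneg_expMeasure hν)
  filter_upwards [hQ.T₀_nonneg, hX, hS, hZ] with ω h1 h2 h3 h4 using ⟨h1, h2, h3, h4⟩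

end IsMG1M

theorem departure_mono_of_nonneg {Ω : Type*} {Q : UpdateDecideSystem Ω} {ω : Ω}
    (hS : ∀ k, 0 ≤ Q.S k ω) : Monotone fun k => Q.departure k ω :=
  monotone_nat_of_le_succ fun k => by
    rw [departure_succ]
    linarith [le_max_right (Q.arrival (k + 1) ω) (Q.departure k ω), hS k]

theorem systemTime_nonneg {Ω : Type*} {Q : UpdateDecideSystem Ω} {ω : Ω} (hT : 0 ≤ Q.T₀ ω)
    (hS : ∀ k, 0 ≤ Q.S k ω) (k : ℕ) : 0 ≤ Q.systemTime k ω := by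
  cases k with
  | zero => rwa [systemTime_zero]
  | succ k =>
    rw [systemTime_succ]
    exact add_nonneg (le_max_right _ _) (hS k)

/-- The departure time of update `k`, minus the total service time until then. -/
noncomputable def unservedTime {Ω : Type*} (Q : UpdateDecideSystem Ω) (k : ℕ) (ω : Ω) : ℝ :=
  Q.departure k ω - ∑ i ∈ Finset.range k, Q.S i ω

/-- Subtracting the service already rendered turns the departure recursion into a pure running
maximum, to which the initial state contributes only as the first term. -/
theorem unservedTime_succ {Ω : Type*} (Q : UpdateDecideSystem Ω) (k : ℕ) (ω : Ω) :
    Q.unservedTime (k + 1) ω =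
      max (Q.arrival (k + 1) ω - ∑ i ∈ Finset.range k, Q.S i ω) (Q.unservedTime k ω) := by
  rw [unservedTime, unservedTime, departure_succ, Finset.sum_range_succ, max_sub_sub_right]
  ring

theorem unservedTime_eq_sum {Ω : Type*} (Q : UpdateDecideSystem Ω) (k : ℕ) (ω : Ω) :
    Q.unservedTime k ω = Q.T₀ ω +
      ∑ i ∈ Finset.range k, max (Q.X i ω - Q.systemTime i ω) 0 := by
  induction k with
  | zero => simp [unservedTime, departure]
  | succ k ih =>
    have h := Q.interDeparture_eq k ω
    rw [Finset.sum_range_succ, ← add_assoc, ← ih]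
    rw [interDeparture] at h
    rw [unservedTime, unservedTime, Finset.sum_range_succ]
    linarith

namespace IsMG1M

variable {Ω : Type*} {Q : UpdateDecideSystem Ω} [MeasurableSpace Ω] {P : Measure Ω}
  {lam μ ν : ℝ} {σ : Measure ℝ}

theorem ae_tendsto_average_X (hQ : Q.IsMG1M P lam σ ν) (hlam : 0 < lam) :
    ∀ᵐ ω ∂P, Tendsto (fun n : ℕ => (∑ i ∈ Finset.range n, Q.X i ω) / n) atTop
      (𝓝 (1 / lam)) := by
  rw [← integral_id_expMeasure hlam]
  exact ae_tendsto_average_of_map_eq hQ.measurable_X hQ.iIndepFun_X hQ.law_X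
    (integrable_id_expMeasure hlam)

theorem ae_tendsto_average_S (hQ : Q.IsMG1M P lam σ ν)
    (hσ_int : Integrable (fun s : ℝ => s) σ) (hσ_mean : ∫ s, s ∂σ = 1 / μ) :
    ∀ᵐ ω ∂P, Tendsto (fun n : ℕ => (∑ i ∈ Finset.range n, Q.S i ω) / n) atTop
      (𝓝 (1 / μ)) := by
  rw [← hσ_mean]
  exact ae_tendsto_average_of_map_eq hQ.measurable_S hQ.iIndepFun_S hQ.law_S hσ_int

/-- The terms of the running maximum have drift 1/λ - 1/μ by the strong law, and this drift is
nonnegative because ρ < 1. -/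
theorem ae_tendsto_unservedTime_div (hQ : Q.IsMG1M P lam σ ν)
    (hlam : 0 < lam) (hρ : lam < μ)
    (hσ_int : Integrable (fun s : ℝ => s) σ) (hσ_mean : ∫ s, s ∂σ = 1 / μ) :
    ∀ᵐ ω ∂P, Tendsto (fun k : ℕ => Q.unservedTime k ω / (k : ℝ)) atTop
      (𝓝 (1 / lam - 1 / μ)) := by
  filter_upwards [hQ.ae_tendsto_average_X hlam, hQ.ae_tendsto_average_S hσ_int hσ_mean]
    with ω hXω hSω
  have hc : 0 ≤ 1 / lam - 1 / μ := sub_nonneg.2 (one_div_le_one_div_of_le hlam hρ.le)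
  refine tendsto_runningMax_div hc ?_ (Q.unservedTime_succ · ω)
  have h1 := hXω.comp (tendsto_add_atTop_nat 1)
  -- Only k service times are summed while the divisor is k + 1, hence the factor k/(k+1).
  have h2 := hSω.mul (tendsto_natCast_div_add_atTop (1 : ℝ))
  rw [mul_one] at h2
  refine (h1.sub h2).congr fun k => ?_
  simp only [Function.comp_apply, arrival]
  rcases k with _ | k
  · simp
  · push_cast
    field_simp

/-- A law of large numbers for functions of the system time, the next inter-arrival time and the
next service time, centred given the system time. -/
theorem ae_tendsto_average_sub_condMean [IsProbabilityMeasure P] (hQ : Q.IsMG1M P lam σ ν)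
    {g : ℝ × ℝ × ℝ → ℝ} (hg : Measurable g) {q : ℝ × ℝ → ℝ} (hq : Measurable q)
    (hq2 : Integrable (fun y => q y ^ 2) ((expMeasure lam).prod σ)) (hgq : ∀ t y, |g (t, y)| ≤ q y) :
    ∀ᵐ ω ∂P, Tendsto (fun n : ℕ => (∑ k ∈ Finset.range n,
      (g (Q.systemTime k ω, Q.X k ω, Q.S k ω) -
        ∫ y, g (Q.systemTime k ω, y) ∂((expMeasure lam).prod σ))) / n) atTop (𝓝 0) := by
  set γ := (expMeasure lam).prod σ with hγ
  have hγP : IsProbabilityMeasure γ := by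
    rw [hγ, ← hQ.map_X_S 0]
    exact Measure.isProbabilityMeasure_map (hQ.measurable_X_S 0).aemeasurable
  have hqint : Integrable q γ :=
    ((memLp_two_iff_integrable_sq hq.aestronglyMeasurable).2 hq2).integrable one_le_two
  set G : ℝ → ℝ := fun t => ∫ y, g (t, y) ∂γ with hG
  have hGm : Measurable G :=
    (hg.stronglyMeasurable.integral_prod_right' (ν := γ)).measurable
  set c := ∫ y, q y ∂γ with hc
  have hgint : ∀ t, Integrable (fun y => g (t, y)) γ := fun t =>
    hqint.mono' (hg.comp measurable_prodMk_left).aestronglyMeasurable (ae_of_all _ (hgq t))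
  have hGc : ∀ t, |G t| ≤ c := fun t =>
    (abs_integral_le_integral_abs).trans (integral_mono (hgint t).abs hqint (hgq t))
  have hlawint : ∀ k, ∀ f : ℝ × ℝ → ℝ, Measurable f →
      ∫ ω, f (Q.X k ω, Q.S k ω) ∂P = ∫ y, f y ∂γ := by
    intro k f hf
    rw [hγ, ← hQ.map_X_S k, integral_map (hQ.measurable_X_S k).aemeasurable hf.aestronglyMeasurable]
  have hDm : ∀ k, Measurable fun ω => g (Q.systemTime k ω, Q.X k ω, Q.S k ω) -
      G (Q.systemTime k ω) := fun k =>
    (hg.comp ((hQ.measurable_systemTime k).prodMk (hQ.measurable_X_S k))).sub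
      (hGm.comp (hQ.measurable_systemTime k))
  have hqP : ∀ k, Integrable (fun ω => 2 * q (Q.X k ω, Q.S k ω) ^ 2 + 2 * c ^ 2) P := by
    intro k
    refine Integrable.add (Integrable.const_mul ?_ _) (integrable_const _)
    rw [hγ, ← hQ.map_X_S k, integrable_map_measure (by fun_prop)
      (hQ.measurable_X_S k).aemeasurable] at hq2
    exact hq2
  have hDsq : ∀ k ω, (g (Q.systemTime k ω, Q.X k ω, Q.S k ω) - G (Q.systemTime k ω)) ^ 2 ≤
      2 * q (Q.X k ω, Q.S k ω) ^ 2 + 2 * c ^ 2 := by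
    intro k ω
    have h1 := sq_le_sq' (abs_le.1 (hgq (Q.systemTime k ω) (Q.X k ω, Q.S k ω))).1
      (abs_le.1 (hgq (Q.systemTime k ω) (Q.X k ω, Q.S k ω))).2
    have h2 := sq_le_sq' (abs_le.1 (hGc (Q.systemTime k ω))).1 (abs_le.1 (hGc (Q.systemTime k ω))).2
    nlinarith [sq_nonneg (g (Q.systemTime k ω, Q.X k ω, Q.S k ω) + G (Q.systemTime k ω))]
  have hDint : ∀ k, Integrable (fun ω => (g (Q.systemTime k ω, Q.X k ω, Q.S k ω) -
      G (Q.systemTime k ω)) ^ 2) P := fun k =>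
    (hqP k).mono' ((hDm k).pow_const 2).aestronglyMeasurable (ae_of_all _ fun ω => by
      rw [Real.norm_of_nonneg (sq_nonneg _)]; exact hDsq k ω)
  refine ae_tendsto_average_of_orthogonal hDm hDint (C := 2 * ∫ y, q y ^ 2 ∂γ + 2 * c ^ 2) ?_ ?_
  · intro k
    refine (integral_mono (hDint k) (hqP k) (hDsq k)).trans_eq ?_
    rw [hlawint k (fun y => 2 * q y ^ 2 + 2 * c ^ 2) (by fun_prop), integral_add
      (hq2.const_mul 2) (integrable_const _), integral_const_mul]
    simp
  · intro j k hjk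
    -- The earlier term is a function of the past of update k, so for a fixed past the product is a
    -- constant times a variable centred in `(X k, S k)`.
    set D' : (ℕ ⊕ ℕ ⊕ ℕ ⊕ Unit → ℝ) → ℝ := fun u =>
      g (canonical.systemTime j u, canonical.X j u, canonical.S j u) -
        G (canonical.systemTime j u) with hD'
    have hD'm : Measurable D' :=
      (hg.comp ((measurable_canonical_systemTime j).prodMk
        ((measurable_pi_apply _).prodMk (measurable_pi_apply _)))).sub
          (hGm.comp (measurable_canonical_systemTime j))
    set ψ : (ℕ ⊕ ℕ ⊕ ℕ ⊕ Unit → ℝ) × (ℝ × ℝ) → ℝ := fun p =>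
      D' p.1 * (g (canonical.systemTime k p.1, p.2) - G (canonical.systemTime k p.1)) with hψ
    have hTk : Measurable fun p : (ℕ ⊕ ℕ ⊕ ℕ ⊕ Unit → ℝ) × (ℝ × ℝ) =>
        canonical.systemTime k p.1 := (measurable_canonical_systemTime k).comp measurable_fst
    have hψm : Measurable ψ :=
      (hD'm.comp measurable_fst).mul ((hg.comp (hTk.prodMk measurable_snd)).sub (hGm.comp hTk))
    have h := (hQ.indepFun_past_X_S k).integral_comp_prodMk_eq_zero (hQ.measurable_past k)
      (hQ.measurable_X_S k) hψm (ae_of_all _ fun ω => by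
        rw [hlawint k (fun y => ψ (Q.past k ω, y)) (hψm.comp measurable_prodMk_left)]
        simp only [hψ]
        rw [integral_const_mul, integral_sub (hgint _) (integrable_const _)]
        simp [hG])
    rw [← h]
    refine integral_congr_ae (ae_of_all _ fun ω => ?_)
    simp only [hψ, hD', systemTime_past ω hjk.le, systemTime_past ω le_rfl, past_X ω hjk,
      past_S ω hjk, hG]

end IsMG1M

end UpdateDecideSystem

/-! ### Long-run averages along the queue -/

theorem integrable_indicator_one {Ω : Type*} [MeasurableSpace Ω] {P : Measure Ω}
    [IsFiniteMeasure P] {A : Set Ω} (hA : MeasurableSet A) :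
    Integrable (A.indicator (1 : Ω → ℝ)) P :=
  (integrable_const (1 : ℝ)).indicator hA

theorem integral_indicator_sub_mul_indicator_sub {Ω : Type*} [MeasurableSpace Ω] {P : Measure Ω}
    [IsProbabilityMeasure P] {A B : Set Ω} (hA : MeasurableSet A) (hB : MeasurableSet B)
    (a b : ℝ) :
    ∫ ω, (A.indicator (1 : Ω → ℝ) ω - a) * (B.indicator (1 : Ω → ℝ) ω - b) ∂P =
      P.real (A ∩ B) - b * P.real A - a * P.real B + a * b := by
  have h : ∀ ω, (A.indicator (1 : Ω → ℝ) ω - a) * (B.indicator (1 : Ω → ℝ) ω - b) =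
      (A ∩ B).indicator (1 : Ω → ℝ) ω - b * A.indicator (1 : Ω → ℝ) ω -
        a * B.indicator (1 : Ω → ℝ) ω + a * b := by
    intro ω
    rw [Set.inter_indicator_one, Pi.mul_apply]
    ring
  have h1 := integrable_indicator_one (P := P) (hA.inter hB)
  have h2 := (integrable_indicator_one (P := P) hA).const_mul b
  have h3 := (integrable_indicator_one (P := P) hB).const_mul a
  have h4 : Integrable (fun ω => (A ∩ B).indicator (1 : Ω → ℝ) ω -
      b * A.indicator (1 : Ω → ℝ) ω) P := h1.sub h2
  have h5 : Integrable (fun ω => (A ∩ B).indicator (1 : Ω → ℝ) ω -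
      b * A.indicator (1 : Ω → ℝ) ω - a * B.indicator (1 : Ω → ℝ) ω) P := h4.sub h3
  simp only [h]
  rw [integral_add h5 (integrable_const _), integral_sub h4 h3, integral_sub h1 h2,
    integral_const_mul, integral_const_mul, integral_indicator_one (hA.inter hB),
    integral_indicator_one hA, integral_indicator_one hB]
  simp

namespace UpdateDecideSystem

namespace IsMG1M

variable {Ω : Type*} {Q : UpdateDecideSystem Ω} [MeasurableSpace Ω] {P : Measure Ω}
  {lam μ ν : ℝ} {σ : Measure ℝ}

/-- The average idle period converges to 1/λ - 1/μ, and it differs from the average of its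
conditional means e^{-λT_k}/λ by a vanishing term. Multiplying by λ gives the limit. -/
theorem ae_tendsto_average_exp_systemTime [IsProbabilityMeasure P] [IsProbabilityMeasure σ]
    (hQ : Q.IsMG1M P lam σ ν) (hlam : 0 < lam) (hν : 0 < ν) (hρ : lam < μ)
    (hσ_nonneg : ∀ᵐ s ∂σ, 0 ≤ s) (hσ_int : Integrable (fun s : ℝ => s) σ)
    (hσ_mean : ∫ s, s ∂σ = 1 / μ) :
    ∀ᵐ ω ∂P, Tendsto (fun n : ℕ => (∑ k ∈ Finset.range n,
      Real.exp (-(lam * Q.systemTime k ω))) / n) atTop (𝓝 (1 - lam / μ)) := by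
  have hexp := isProbabilityMeasure_expMeasure hlam
  have hmd := hQ.ae_tendsto_average_sub_condMean
    -- Truncating the system time at 0 gives the bound |X| for all real arguments; it changes
    -- nothing almost surely, since system times are nonnegative.
    (g := fun p => max (p.2.1 - max p.1 0) 0) (by fun_prop)
    (q := fun y => |y.1|) (by fun_prop)
    (by
      simp only [sq_abs]
      exact (integrable_sq_expMeasure hlam).comp_fst σ)
    (fun t y => by
      rw [abs_of_nonneg (le_max_right _ _)]
      exact max_le (by linarith [le_max_right t 0, le_abs_self y.1]) (abs_nonneg _))
  filter_upwards [hmd, hQ.ae_tendsto_unservedTime_div hlam hρ hσ_int hσ_mean,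
    hQ.ae_nonneg hlam hν hσ_nonneg] with ω h1 h2 ⟨hT, hX, hS, hZ⟩
  have hT0 := systemTime_nonneg hT hS
  have hG : ∀ k, ∫ y, max (y.1 - Q.systemTime k ω) 0 ∂((expMeasure lam).prod σ) =
      Real.exp (-(lam * Q.systemTime k ω)) / lam := by
    intro k
    rw [integral_fun_fst (fun x => max (x - Q.systemTime k ω) 0),
      integral_excess_id_expMeasure hlam (hT0 k)]
    simp
  simp only [max_eq_left (hT0 _), hG] at h1
  have hz : Tendsto (fun n : ℕ => Q.T₀ ω / (n : ℝ)) atTop (𝓝 0) :=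
    tendsto_const_div_atTop_nhds_zero_nat _
  have h3 := (((h2.sub hz).sub h1).const_mul lam)
  have hlim : lam * (1 / lam - 1 / μ - 0 - 0) = 1 - lam / μ := by
    have : μ ≠ 0 := (hlam.trans hρ).ne'
    field_simp
    ring
  rw [hlim] at h3
  refine h3.congr fun n => ?_
  rw [unservedTime_eq_sum, Finset.sum_sub_distrib, ← Finset.sum_div]
  field_simp
  ring

theorem ae_tendsto_average_exp_interDeparture [IsProbabilityMeasure P] [IsProbabilityMeasure σ]
    (hQ : Q.IsMG1M P lam σ ν) (hlam : 0 < lam) (hν : 0 < ν) (hρ : lam < μ)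
    (hσ_nonneg : ∀ᵐ s ∂σ, 0 ≤ s) (hσ_int : Integrable (fun s : ℝ => s) σ)
    (hσ_mean : ∫ s, s ∂σ = 1 / μ) :
    ∀ᵐ ω ∂P, Tendsto (fun n : ℕ => (∑ k ∈ Finset.range n,
      Real.exp (-ν * Q.interDeparture k ω)) / n) atTop
        (𝓝 (mgf id σ (-ν) * ((lam / μ * ν + lam) / (lam + ν)))) := by
  have hexp := isProbabilityMeasure_expMeasure hlam
  have hmd := hQ.ae_tendsto_average_sub_condMean
    -- The truncations at 0 bound this by 1 everywhere; they disappear on the almost sure event that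
    -- the data are nonnegative.
    (g := fun p => Real.exp (-ν * max (p.2.1 - max p.1 0) 0) * Real.exp (-ν * max p.2.2 0))
    (by fun_prop) (q := fun _ => 1) (by fun_prop) (by simp)
    (fun t y => by
      rw [abs_of_nonneg (by positivity), ← Real.exp_add, Real.exp_le_one_iff]
      have h1 := mul_nonneg hν.le (le_max_right (y.1 - max t 0) 0)
      have h2 := mul_nonneg hν.le (le_max_right y.2 0)
      linarith)
  filter_upwards [hmd, hQ.ae_tendsto_average_exp_systemTime hlam hν hρ hσ_nonneg hσ_int hσ_mean,
    hQ.ae_nonneg hlam hν hσ_nonneg] with ω h1 h2 ⟨hT, hX, hS, hZ⟩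
  have hT0 := systemTime_nonneg hT hS
  have hmgf : ∫ s, Real.exp (-ν * max s 0) ∂σ = mgf id σ (-ν) :=
    integral_congr_ae (hσ_nonneg.mono fun s hs => by simp [max_eq_left hs])
  have hG : ∀ k, ∫ y, Real.exp (-ν * max (y.1 - Q.systemTime k ω) 0) *
      Real.exp (-ν * max y.2 0) ∂((expMeasure lam).prod σ) =
      (1 - Real.exp (-(lam * Q.systemTime k ω)) * (ν / (lam + ν))) * mgf id σ (-ν) := by
    intro k
    rw [integral_prod_mul (fun x => Real.exp (-ν * max (x - Q.systemTime k ω) 0))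
      (fun s => Real.exp (-ν * max s 0)), hmgf,
      integral_exp_neg_excess_expMeasure hlam hν (hT0 k)]
  have hY : ∀ k, Real.exp (-ν * max (Q.X k ω - Q.systemTime k ω) 0) *
      Real.exp (-ν * max (Q.S k ω) 0) = Real.exp (-ν * Q.interDeparture k ω) := by
    intro k
    rw [interDeparture_eq, max_eq_left (hS k), ← Real.exp_add, mul_add]
  simp only [max_eq_left (hT0 _), hG] at h1
  simp only [max_eq_left (hS _)] at hY
  simp only [max_eq_left (hS _), hY] at h1
  have h3 := h1.add (((h2.mul_const (ν / (lam + ν))).const_sub 1).mul_const (mgf id σ (-ν)))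
  have hlim : 0 + (1 - (1 - lam / μ) * (ν / (lam + ν))) * mgf id σ (-ν) =
      mgf id σ (-ν) * ((lam / μ * ν + lam) / (lam + ν)) := by
    have : μ ≠ 0 := (hlam.trans hρ).ne'
    have : lam + ν ≠ 0 := by positivity
    field_simp
    ring
  rw [hlim] at h3
  refine h3.congr' ?_
  filter_upwards [eventually_ge_atTop 1] with n hn
  have hn0 : (n : ℝ) ≠ 0 := by positivity
  rw [Finset.sum_sub_distrib, ← Finset.sum_mul, Finset.sum_sub_distrib, ← Finset.sum_mul]
  simp only [Finset.sum_const, Finset.card_range, nsmul_eq_mul, mul_one]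
  field_simp
  ring

end IsMG1M

/-! ### Missed updates as void events -/

/-- No decision is made between the departures of updates `k` and `k + 1`, as an event in terms of
the data of the queue and the inter-decision times. -/
def noDecision (k : ℕ) : Set ((ℕ ⊕ ℕ ⊕ ℕ ⊕ Unit → ℝ) × (ℕ → ℝ)) :=
  {p | ∀ j, epoch p.2 j ∉ Set.Ico (canonical.departure k p.1) (canonical.departure (k + 1) p.1)}

theorem measurableSet_noDecision (k : ℕ) : MeasurableSet (noDecision k) := by
  have h : noDecision k = ⋂ j, {p : (ℕ ⊕ ℕ ⊕ ℕ ⊕ Unit → ℝ) × (ℕ → ℝ) |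
      canonical.departure k p.1 ≤ epoch p.2 j ∧
        epoch p.2 j < canonical.departure (k + 1) p.1}ᶜ := by
    ext p
    simp [noDecision]
  rw [h]
  refine MeasurableSet.iInter fun j => MeasurableSet.compl ?_
  have h1 : Measurable fun p : (ℕ ⊕ ℕ ⊕ ℕ ⊕ Unit → ℝ) × (ℕ → ℝ) => epoch p.2 j :=
    (measurable_epoch j).comp measurable_snd
  exact (measurableSet_le ((measurable_canonical_departure k).comp measurable_fst) h1).inter
    (measurableSet_lt h1 ((measurable_canonical_departure (k + 1)).comp measurable_fst))

variable {Ω : Type*} {Q : UpdateDecideSystem Ω}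

theorem mem_noDecision {k : ℕ} {ω ω' : Ω} :
    (Q.queueData ω, fun i => Q.Z i ω') ∈ noDecision k ↔
      ∀ j, epoch (fun i => Q.Z i ω') j ∉
        Set.Ico (Q.departure k ω) (Q.departure (k + 1) ω) := by
  simp only [noDecision, Set.mem_ofPred_eq, departure_queueData]

theorem indicator_noDecision (k : ℕ) (ω ω' : Ω) :
    (noDecision k).indicator (1 : _ × _ → ℝ) (Q.queueData ω, fun i => Q.Z i ω') =
      {ω' | ∀ j, epoch (fun i => Q.Z i ω') j ∉
        Set.Ico (Q.departure k ω) (Q.departure (k + 1) ω)}.indicator (1 : Ω → ℝ) ω' := by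
  have h := mem_noDecision (Q := Q) (k := k) (ω := ω) (ω' := ω')
  by_cases hmem : (Q.queueData ω, fun i => Q.Z i ω') ∈ noDecision k
  · rw [Set.indicator_of_mem hmem, Set.indicator_of_mem (Set.mem_ofPred_eq ▸ h.1 hmem)]
    rfl
  · rw [Set.indicator_of_notMem hmem, Set.indicator_of_notMem]
    rwa [Set.mem_ofPred_eq, ← h]

theorem mem_noDecision_iff_numDecisions_eq_zero {k : ℕ} {ω : Ω} :
    (Q.queueData ω, fun i => Q.Z i ω) ∈ noDecision k ↔ Q.numDecisions k ω = 0 := by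
  rw [mem_noDecision, numDecisions, Set.encard_eq_zero, Set.eq_empty_iff_forall_notMem]
  rfl

/-- Departures are nondecreasing, so the updates received by time t form an initial segment. If two
consecutive departures coincide, the interval is empty and the earlier update is never used. -/
theorem usedAt_iff {k : ℕ} {ω : Ω} (hS : ∀ k, 0 ≤ Q.S k ω) {t : ℝ} :
    Q.UsedAt k ω t ↔ Q.departure k ω ≤ t ∧ t < Q.departure (k + 1) ω := by
  have hmono := departure_mono_of_nonneg hS
  refine and_congr_right fun _ => ⟨fun h => ?_, fun h i hi => ?_⟩
  · by_contra hlt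
    exact absurd (h (not_lt.1 hlt)) (Nat.not_succ_le_self k)
  · by_contra hlt
    exact absurd (h.trans_le ((hmono (Nat.succ_le_of_lt (not_le.1 hlt))).trans hi))
      (lt_irrefl t)

theorem missed_iff_numDecisions_eq_zero {k : ℕ} {ω : Ω} (hS : ∀ k, 0 ≤ Q.S k ω) :
    Q.Missed k ω ↔ Q.numDecisions k ω = 0 := by
  rw [numDecisions, Set.encard_eq_zero, Set.eq_empty_iff_forall_notMem]
  exact forall_congr' fun j => not_congr (usedAt_iff hS)

theorem interDeparture_queueData {k : ℕ} (ω : Ω) :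
    canonical.interDeparture k (Q.queueData ω) = Q.interDeparture k ω := by
  rw [interDeparture, interDeparture, departure_queueData, departure_queueData]

/-- The indicator of the event that no decision is made between the departures of updates `k` and
`k + 1`, minus its conditional probability given the data of the queue. -/
noncomputable def centredNoDecision (ν : ℝ) (k : ℕ)
    (p : (ℕ ⊕ ℕ ⊕ ℕ ⊕ Unit → ℝ) × (ℕ → ℝ)) : ℝ :=
  (noDecision k).indicator 1 p - Real.exp (-ν * canonical.interDeparture k p.1)

theorem measurable_centredNoDecision (ν : ℝ) (k : ℕ) : Measurable (centredNoDecision ν k) := by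
  have h1 : Measurable (canonical.interDeparture k) :=
    (measurable_canonical_departure (k + 1)).sub (measurable_canonical_departure k)
  exact (measurable_one.indicator (measurableSet_noDecision k)).sub
    (((h1.comp measurable_fst).const_mul (-ν)).exp)

namespace IsMG1M

variable [MeasurableSpace Ω] {P : Measure Ω} {lam μ ν : ℝ} {σ : Measure ℝ}

theorem measurable_Z_seq (hQ : Q.IsMG1M P lam σ ν) : Measurable fun ω i => Q.Z i ω :=
  measurable_pi_iff.2 hQ.measurable_Z

theorem measurableSet_noDecision_section (hQ : Q.IsMG1M P lam σ ν) (k : ℕ) (ω : Ω) :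
    MeasurableSet {ω' | ∀ j, epoch (fun i => Q.Z i ω') j ∉
      Set.Ico (Q.departure k ω) (Q.departure (k + 1) ω)} := by
  simp only [← mem_noDecision (Q := Q)]
  exact (measurable_const.prodMk hQ.measurable_Z_seq) (measurableSet_noDecision k)

theorem integral_centredNoDecision [IsProbabilityMeasure P] (hQ : Q.IsMG1M P lam σ ν)
    (hlam : 0 < lam) (hν : 0 < ν) (hσ_nonneg : ∀ᵐ s ∂σ, 0 ≤ s) (k : ℕ) :
    ∫ ω, centredNoDecision ν k (Q.queueData ω, fun i => Q.Z i ω) ∂P = 0 := by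
  refine hQ.indepFun_queueData_Z.integral_comp_prodMk_eq_zero hQ.measurable_queueData
    hQ.measurable_Z_seq (measurable_centredNoDecision ν k) ?_
  filter_upwards [hQ.ae_nonneg hlam hν hσ_nonneg] with ω ⟨hT, hX, hS, hZ⟩
  have hmono := departure_mono_of_nonneg hS
  have hstep : ∀ k, Q.departure k ω ≤ Q.departure (k + 1) ω := fun k => hmono (Nat.le_succ k)
  have h0 : 0 ≤ Q.departure k ω := le_trans hT (hmono (Nat.zero_le k))
  have h1 := measureReal_noEpoch_Ico hν hQ.measurable_Z hQ.iIndepFun_Z hQ.law_Z h0 (hstep k)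
  have hm := hQ.measurableSet_noDecision_section k ω
  set A := {ω' | ∀ j, epoch (fun i => Q.Z i ω') j ∉
      Set.Ico (Q.departure k ω) (Q.departure (k + 1) ω)} with hA
  have h2 : ∀ ω', (noDecision k).indicator (1 : _ × _ → ℝ) (Q.queueData ω, fun i => Q.Z i ω') =
      A.indicator 1 ω' := fun ω' => by
    exact indicator_noDecision k ω ω'
  simp only [centredNoDecision, h2, interDeparture_queueData]
  rw [integral_sub (integrable_indicator_one hm) (integrable_const _),
    integral_indicator_one hm, h1, interDeparture]
  simp

/-- Freeze the queue: the two departure intervals become deterministic, and the earlier one lies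
below the start of the later one. The two void events of the Poisson process are then independent,
so their covariance vanishes. -/
theorem integral_centredNoDecision_mul [IsProbabilityMeasure P] (hQ : Q.IsMG1M P lam σ ν)
    (hlam : 0 < lam) (hν : 0 < ν) (hσ_nonneg : ∀ᵐ s ∂σ, 0 ≤ s) {j k : ℕ} (hjk : j < k) :
    ∫ ω, centredNoDecision ν j (Q.queueData ω, fun i => Q.Z i ω) *
      centredNoDecision ν k (Q.queueData ω, fun i => Q.Z i ω) ∂P = 0 := by
  refine hQ.indepFun_queueData_Z.integral_comp_prodMk_eq_zero hQ.measurable_queueData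
    hQ.measurable_Z_seq (ψ := fun p => centredNoDecision ν j p * centredNoDecision ν k p)
    ((measurable_centredNoDecision ν j).mul (measurable_centredNoDecision ν k)) ?_
  filter_upwards [hQ.ae_nonneg hlam hν hσ_nonneg] with ω ⟨hT, hX, hS, hZ⟩
  have hmono := departure_mono_of_nonneg hS
  have hstep : ∀ k, Q.departure k ω ≤ Q.departure (k + 1) ω := fun k => hmono (Nat.le_succ k)
  have h0 : ∀ k, 0 ≤ Q.departure k ω := fun k => le_trans hT (hmono (Nat.zero_le k))
  have h1 := fun k => measureReal_noEpoch_Ico hν hQ.measurable_Z hQ.iIndepFun_Z hQ.law_Z (h0 k)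
    (hstep k)
  have hm := fun k => hQ.measurableSet_noDecision_section k ω
  have hsub : Set.Ico (Q.departure j ω) (Q.departure (j + 1) ω) ⊆
      Set.Iio (Q.departure k ω) := fun t ht =>
    ht.2.trans_le (hmono (Nat.succ_le_of_lt hjk))
  have h12 := measureReal_noEpoch hν hQ.measurable_Z hQ.iIndepFun_Z hQ.law_Z measurableSet_Ico
    hsub (h0 k) (hstep k)
  set A : ℕ → Set Ω := fun k => {ω' | ∀ j, epoch (fun i => Q.Z i ω') j ∉
      Set.Ico (Q.departure k ω) (Q.departure (k + 1) ω)} with hA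
  have hAA : {ω' | ∀ i, epoch (fun i => Q.Z i ω') i ∉
      Set.Ico (Q.departure j ω) (Q.departure (j + 1) ω) ∧ epoch (fun i => Q.Z i ω') i ∉
      Set.Ico (Q.departure k ω) (Q.departure (k + 1) ω)} = A j ∩ A k := by
    ext ω'
    exact forall_and
  rw [hAA] at h12
  change P.real (A j ∩ A k) = _ * P.real (A j) at h12
  have h1' : ∀ k, P.real (A k) = Real.exp (-ν * Q.interDeparture k ω) := fun k => by
    rw [neg_mul]
    exact h1 k
  have h12' : P.real (A j ∩ A k) =
      Real.exp (-ν * Q.interDeparture k ω) * Real.exp (-ν * Q.interDeparture j ω) := by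
    rw [h12, h1' j]
    simp only [interDeparture, neg_mul]
  have h2 : ∀ k ω', (noDecision k).indicator (1 : _ × _ → ℝ) (Q.queueData ω, fun i => Q.Z i ω') =
      (A k).indicator 1 ω' := fun k ω' => by
    exact indicator_noDecision k ω ω'
  simp only [centredNoDecision, h2, interDeparture_queueData]
  set a := Real.exp (-ν * Q.interDeparture j ω)
  set b := Real.exp (-ν * Q.interDeparture k ω)
  rw [integral_indicator_sub_mul_indicator_sub (hm j) (hm k), h12', h1' j, h1' k]
  ring

theorem ae_centredNoDecision_le [IsProbabilityMeasure P] (hQ : Q.IsMG1M P lam σ ν)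
    (hlam : 0 < lam) (hν : 0 < ν) (hσ_nonneg : ∀ᵐ s ∂σ, 0 ≤ s) (k : ℕ) :
    ∀ᵐ ω ∂P, Real.exp (-ν * Q.interDeparture k ω) ≤ 1 ∧
      |centredNoDecision ν k (Q.queueData ω, fun i => Q.Z i ω)| ≤ 1 := by
  filter_upwards [hQ.ae_nonneg hlam hν hσ_nonneg] with ω ⟨hT, hX, hS, hZ⟩
  have h1 : 0 ≤ Q.interDeparture k ω :=
    sub_nonneg.2 (departure_mono_of_nonneg hS (Nat.le_succ k))
  have h2 : Real.exp (-ν * Q.interDeparture k ω) ≤ 1 := by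
    rw [Real.exp_le_one_iff]; nlinarith
  have h3 := Real.exp_pos (-ν * Q.interDeparture k ω)
  refine ⟨h2, ?_⟩
  rw [centredNoDecision, interDeparture_queueData, Set.indicator]
  split_ifs
  · rw [abs_le, Pi.one_apply]; constructor <;> linarith
  · rw [abs_le]; constructor <;> linarith

theorem ae_tendsto_average_centredNoDecision [IsProbabilityMeasure P]
    (hQ : Q.IsMG1M P lam σ ν) (hlam : 0 < lam) (hν : 0 < ν) (hσ_nonneg : ∀ᵐ s ∂σ, 0 ≤ s) :
    ∀ᵐ ω ∂P, Tendsto (fun n : ℕ => (∑ k ∈ Finset.range n,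
      centredNoDecision ν k (Q.queueData ω, fun i => Q.Z i ω)) / n) atTop (𝓝 0) := by
  have hm : ∀ k, Measurable fun ω => centredNoDecision ν k (Q.queueData ω, fun i => Q.Z i ω) :=
    fun k => (measurable_centredNoDecision ν k).comp
      (hQ.measurable_queueData.prodMk hQ.measurable_Z_seq)
  have hle : ∀ k, ∀ᵐ ω ∂P, centredNoDecision ν k (Q.queueData ω, fun i => Q.Z i ω) ^ 2 ≤ 1 :=
    fun k => (hQ.ae_centredNoDecision_le hlam hν hσ_nonneg k).mono fun ω h =>
      (sq_le_one_iff_abs_le_one _).2 h.2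
  have hint : ∀ k, Integrable
      (fun ω => centredNoDecision ν k (Q.queueData ω, fun i => Q.Z i ω) ^ 2) P := fun k =>
    Integrable.of_bound (C := 1) ((hm k).pow_const 2).aestronglyMeasurable
      ((hle k).mono fun ω h => by rwa [Real.norm_of_nonneg (sq_nonneg _)])
  refine ae_tendsto_average_of_orthogonal hm hint (C := 1) (fun k => ?_) fun j k hjk =>
    hQ.integral_centredNoDecision_mul hlam hν hσ_nonneg hjk
  refine (integral_mono_ae (hint k) (integrable_const 1) (hle k)).trans_eq ?_
  simp

theorem integrable_exp_interDeparture [IsProbabilityMeasure P] (hQ : Q.IsMG1M P lam σ ν)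
    (hlam : 0 < lam) (hν : 0 < ν) (hσ_nonneg : ∀ᵐ s ∂σ, 0 ≤ s) (k : ℕ) :
    Integrable (fun ω => Real.exp (-ν * Q.interDeparture k ω)) P :=
  Integrable.of_bound (C := 1)
    ((hQ.measurable_interDeparture k).const_mul (-ν)).exp.aestronglyMeasurable
    ((hQ.ae_centredNoDecision_le hlam hν hσ_nonneg k).mono fun ω h => by
      rw [Real.norm_of_nonneg (Real.exp_pos _).le]; exact h.1)

/-- The probability that no decision is made between two departures. -/
theorem measureReal_numDecisions_eq_zero [IsProbabilityMeasure P] (hQ : Q.IsMG1M P lam σ ν)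
    (hlam : 0 < lam) (hν : 0 < ν) (hσ_nonneg : ∀ᵐ s ∂σ, 0 ≤ s) (k : ℕ) :
    P.real {ω | Q.numDecisions k ω = 0} = ∫ ω, Real.exp (-ν * Q.interDeparture k ω) ∂P := by
  have h := hQ.integral_centredNoDecision hlam hν hσ_nonneg k
  have hm : MeasurableSet {ω | Q.numDecisions k ω = 0} := by
    simp only [← mem_noDecision_iff_numDecisions_eq_zero]
    exact (hQ.measurable_queueData.prodMk hQ.measurable_Z_seq) (measurableSet_noDecision k)
  have h2 : ∀ ω, (noDecision k).indicator (1 : _ × _ → ℝ) (Q.queueData ω, fun i => Q.Z i ω) =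
      {ω | Q.numDecisions k ω = 0}.indicator 1 ω := fun ω => by
    simp only [Set.indicator, mem_noDecision_iff_numDecisions_eq_zero, Set.mem_ofPred_eq,
      Pi.one_apply]
  simp only [centredNoDecision, h2, interDeparture_queueData] at h
  rw [integral_sub (integrable_indicator_one hm)
    (hQ.integrable_exp_interDeparture hlam hν hσ_nonneg k), integral_indicator_one hm] at h
  linarith

/-- The long-run fraction of missed updates. -/
theorem ae_tendsto_numMissed_div [IsProbabilityMeasure P] [IsProbabilityMeasure σ]
    (hQ : Q.IsMG1M P lam σ ν) (hlam : 0 < lam) (hν : 0 < ν) (hρ : lam < μ)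
    (hσ_nonneg : ∀ᵐ s ∂σ, 0 ≤ s) (hσ_int : Integrable (fun s : ℝ => s) σ)
    (hσ_mean : ∫ s, s ∂σ = 1 / μ) :
    ∀ᵐ ω ∂P, Tendsto (fun n : ℕ => (Q.numMissed n ω : ℝ) / n) atTop
      (𝓝 (mgf id σ (-ν) * ((lam / μ * ν + lam) / (lam + ν)))) := by
  classical
  filter_upwards [hQ.ae_tendsto_average_exp_interDeparture hlam hν hρ hσ_nonneg hσ_int hσ_mean,
    hQ.ae_tendsto_average_centredNoDecision hlam hν hσ_nonneg,
    hQ.ae_nonneg hlam hν hσ_nonneg] with ω h1 h2 ⟨hT, hX, hS, hZ⟩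
  set M : ℕ → ℝ := fun k => if Q.Missed k ω then 1 else 0 with hM
  have hMeq : ∀ k, centredNoDecision ν k (Q.queueData ω, fun i => Q.Z i ω) +
      Real.exp (-ν * Q.interDeparture k ω) = M k := by
    intro k
    simp only [centredNoDecision, interDeparture_queueData, hM, sub_add_cancel, Set.indicator,
      mem_noDecision_iff_numDecisions_eq_zero, missed_iff_numDecisions_eq_zero hS, Pi.one_apply]
  have h3 := h2.add h1
  simp only [← add_div, ← Finset.sum_add_distrib, hMeq, zero_add] at h3
  -- The average over 0, …, n has divisor n + 1, whereas updates 1, …, n are counted with divisor n: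
  -- rescale by (n+1)/n and discard update 0, which contributes at most 1/n.
  have h4 := (h3.comp (tendsto_add_atTop_nat 1)).mul
    ((tendsto_natCast_div_add_atTop (1 : ℝ)).inv₀ one_ne_zero)
  have h5 : Tendsto (fun n : ℕ => M 0 / (n : ℝ)) atTop (𝓝 0) :=
    tendsto_const_div_atTop_nhds_zero_nat _
  have h6 := h4.sub h5
  rw [inv_one, mul_one, sub_zero] at h6
  refine h6.congr' ?_
  filter_upwards [eventually_ge_atTop 1] with n hn
  have hnum : (Q.numMissed n ω : ℝ) = ∑ k ∈ Finset.Icc 1 n, M k := by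
    rw [numMissed, Finset.card_filter]
    push_cast
    refine Finset.sum_congr rfl fun k _ => ?_
    simp only [hM]
  have hsum : ∑ k ∈ Finset.range (n + 1), M k = M 0 + ∑ k ∈ Finset.Icc 1 n, M k := by
    rw [Finset.range_eq_Ico, Finset.sum_eq_sum_Ico_succ_bot (Nat.succ_pos n)]
    rfl
  simp only [Function.comp_apply]
  rw [hnum, hsum]
  have hn0 : (n : ℝ) ≠ 0 := by positivity
  push_cast
  field_simp
  ring

end IsMG1M

end UpdateDecideSystem

/-! ### Values in the stationary regime -/

namespace UpdateDecideSystem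

namespace IsMG1M

variable {Ω : Type*} {Q : UpdateDecideSystem Ω} [MeasurableSpace Ω] {P : Measure Ω}
  {lam μ ν : ℝ} {σ : Measure ℝ}

theorem map_systemTime_X_S [IsProbabilityMeasure P] (hQ : Q.IsMG1M P lam σ ν) (k : ℕ) :
    P.map (fun ω => (Q.systemTime k ω, Q.X k ω, Q.S k ω)) =
      (P.map (Q.systemTime k)).prod ((expMeasure lam).prod σ) := by
  rw [(indepFun_iff_map_prod_eq_prod_map_map (hQ.measurable_systemTime k).aemeasurable
    (hQ.measurable_X_S k).aemeasurable).1 (hQ.indepFun_systemTime_X_S k), hQ.map_X_S]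

theorem map_systemTime_succ [IsProbabilityMeasure P] (hQ : Q.IsMG1M P lam σ ν) (k : ℕ) :
    P.map (Q.systemTime (k + 1)) =
      ((P.map (Q.systemTime k)).prod ((expMeasure lam).prod σ)).map
        (fun p : ℝ × ℝ × ℝ => max (p.1 - p.2.1) 0 + p.2.2) := by
  rw [← hQ.map_systemTime_X_S k, Measure.map_map (by fun_prop)
    ((hQ.measurable_systemTime k).prodMk (hQ.measurable_X_S k))]
  congr 1
  funext ω
  exact Q.systemTime_succ k ω

theorem map_systemTime_eq [IsProbabilityMeasure P] (hQ : Q.IsMG1M P lam σ ν)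
    (hstat : IsStationarySystemTimeLaw lam σ (P.map Q.T₀)) (k : ℕ) :
    P.map (Q.systemTime k) = P.map Q.T₀ := by
  induction k with
  | zero => rw [show Q.systemTime 0 = Q.T₀ from funext Q.systemTime_zero]
  | succ k ih => rw [hQ.map_systemTime_succ, ih, hstat.2]

/-- The inter-departure time is a fixed function of the system time, the next inter-arrival time and
the next service time, whose joint law does not depend on k under stationarity. -/
theorem integral_exp_interDeparture_eq_initial [IsProbabilityMeasure P]
    (hQ : Q.IsMG1M P lam σ ν) (hstat : IsStationarySystemTimeLaw lam σ (P.map Q.T₀)) (k : ℕ) :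
    ∫ ω, Real.exp (-ν * Q.interDeparture k ω) ∂P =
      ∫ ω, Real.exp (-ν * Q.interDeparture 0 ω) ∂P := by
  have h : ∀ k, ∫ ω, Real.exp (-ν * Q.interDeparture k ω) ∂P =
      ∫ p, Real.exp (-ν * (max (p.2.1 - p.1) 0 + p.2.2))
        ∂((P.map Q.T₀).prod ((expMeasure lam).prod σ)) := by
    intro k
    rw [← hQ.map_systemTime_eq hstat k, ← hQ.map_systemTime_X_S k, integral_map
      ((hQ.measurable_systemTime k).prodMk (hQ.measurable_X_S k)).aemeasurable (by fun_prop)]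
    simp only [interDeparture_eq]
  rw [h k, h 0]

/-- The stationary value of the Laplace transform of the inter-departure times. -/
theorem integral_exp_interDeparture [IsProbabilityMeasure P] [IsProbabilityMeasure σ]
    (hQ : Q.IsMG1M P lam σ ν) (hlam : 0 < lam) (hν : 0 < ν) (hρ : lam < μ)
    (hσ_nonneg : ∀ᵐ s ∂σ, 0 ≤ s) (hσ_int : Integrable (fun s : ℝ => s) σ)
    (hσ_mean : ∫ s, s ∂σ = 1 / μ) (hstat : IsStationarySystemTimeLaw lam σ (P.map Q.T₀))
    (k : ℕ) :
    ∫ ω, Real.exp (-ν * Q.interDeparture k ω) ∂P =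
      mgf id σ (-ν) * ((lam / μ * ν + lam) / (lam + ν)) := by
  have hlim := hQ.ae_tendsto_average_exp_interDeparture hlam hν hρ hσ_nonneg hσ_int hσ_mean
  have hint := hQ.integrable_exp_interDeparture hlam hν hσ_nonneg
  have hle : ∀ᵐ ω ∂P, ∀ k, Real.exp (-ν * Q.interDeparture k ω) ≤ 1 := ae_all_iff.2 fun k =>
    (hQ.ae_centredNoDecision_le hlam hν hσ_nonneg k).mono fun ω h => h.1
  have h1 := tendsto_integral_of_dominated_convergence (μ := P) (fun _ => (1 : ℝ))
    (fun n => (((integrable_finsetSum (Finset.range n) fun k _ => hint k).div_const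
      (n : ℝ)).aestronglyMeasurable)) (integrable_const _) (fun n => hle.mono fun ω h => by
        rw [Real.norm_of_nonneg (by positivity)]
        refine div_le_one_of_le₀ ?_ (Nat.cast_nonneg n)
        calc ∑ k ∈ Finset.range n, Real.exp (-ν * Q.interDeparture k ω)
            ≤ ∑ k ∈ Finset.range n, (1 : ℝ) := Finset.sum_le_sum fun k _ => h k
          _ = n := by simp) hlim
  rw [integral_const, probReal_univ, one_smul] at h1
  rw [hQ.integral_exp_interDeparture_eq_initial hstat k]
  -- The expected averages are constant for n ≥ 1, so they equal the limit given by dominated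
  -- convergence.
  refine tendsto_nhds_unique (tendsto_const_nhds.congr' ?_) h1
  filter_upwards [eventually_ge_atTop 1] with n hn
  have hn0 : (n : ℝ) ≠ 0 := by positivity
  rw [integral_div, integral_finsetSum _ fun k _ => hint k]
  simp only [hQ.integral_exp_interDeparture_eq_initial hstat]
  rw [Finset.sum_const, Finset.card_range, nsmul_eq_mul]
  field_simp

end IsMG1M

/-! ### Coupling and uniqueness of the stationary law -/

/-- The system with the same inter-arrival, service and inter-decision times, in which update `0`
spends the time `x` in the system. -/
def withInitial {Ω : Type*} (Q : UpdateDecideSystem Ω) (x : ℝ) : UpdateDecideSystem Ω where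
  T₀ _ := x
  X := Q.X
  S := Q.S
  Z := Q.Z

/-- Raising the first term of a running maximum from 0 to x amounts to taking the maximum with x at
every time. -/
theorem unservedTime_withInitial {Ω : Type*} (Q : UpdateDecideSystem Ω) {x : ℝ} (hx : 0 ≤ x)
    (k : ℕ) (ω : Ω) :
    (Q.withInitial x).unservedTime k ω = max x ((Q.withInitial 0).unservedTime k ω) := by
  induction k with
  | zero => simp [unservedTime, departure, withInitial, hx]
  | succ k ih =>
    rw [unservedTime_succ, ih, unservedTime_succ, max_left_comm]
    rfl

theorem systemTime_withInitial {Ω : Type*} (Q : UpdateDecideSystem Ω) {x : ℝ} (hx : 0 ≤ x)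
    (k : ℕ) (ω : Ω) :
    (Q.withInitial x).systemTime k ω = max x ((Q.withInitial 0).unservedTime k ω) +
      ∑ i ∈ Finset.range k, Q.S i ω - Q.arrival k ω := by
  rw [← Q.unservedTime_withInitial hx, unservedTime]
  simp only [systemTime, withInitial, sub_add_cancel]
  rfl

namespace IsMG1M

variable {Ω : Type*} {Q : UpdateDecideSystem Ω} [MeasurableSpace Ω] {P : Measure Ω}
  {lam μ ν : ℝ} {σ : Measure ℝ}

theorem withInitial (hQ : Q.IsMG1M P lam σ ν) {x : ℝ} (hx : 0 ≤ x) :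
    (Q.withInitial x).IsMG1M P lam σ ν where
  measurable_T₀ := measurable_const
  measurable_X := hQ.measurable_X
  measurable_S := hQ.measurable_S
  measurable_Z := hQ.measurable_Z
  T₀_nonneg := ae_of_all _ fun _ => hx
  law_X := hQ.law_X
  law_S := hQ.law_S
  law_Z := hQ.law_Z
  indep := by
    -- Composing the coordinate of the initial state with a constant map preserves independence.
    have h := hQ.indep.comp
      (Sum.elim (fun _ => id) (Sum.elim (fun _ => id) (Sum.elim (fun _ => id) fun _ _ => x)))
      (by
        rintro (i | i | i | i)
        exacts [measurable_id, measurable_id, measurable_id, measurable_const])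
    convert h using 1
    funext i
    rcases i with i | i | i | i <;> rfl

theorem lintegral_systemTime_succ [IsProbabilityMeasure P] [IsProbabilityMeasure σ]
    (hQ : Q.IsMG1M P lam σ ν) (hlam : 0 < lam) {g : ℝ → ENNReal} (hg : Measurable g) (k : ℕ) :
    ∫⁻ ω, g (Q.systemTime (k + 1) ω) ∂P =
      ∫⁻ ω, ∫⁻ y, g (max (Q.systemTime k ω - y.1) 0 + y.2) ∂((expMeasure lam).prod σ) ∂P := by
  have hexp := isProbabilityMeasure_expMeasure hlam
  have hf : Measurable fun p : ℝ × ℝ × ℝ => g (max (p.1 - p.2.1) 0 + p.2.2) := by fun_prop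
  rw [← lintegral_map hg (hQ.measurable_systemTime (k + 1)), hQ.map_systemTime_succ,
    lintegral_map hg (by fun_prop), lintegral_prod _ hf.aemeasurable,
    lintegral_map hf.lintegral_prod_right' (hQ.measurable_systemTime k)]

end IsMG1M

end UpdateDecideSystem

theorem IsStationarySystemTimeLaw.ae_nonneg {lam : ℝ} (hlam : 0 < lam) {σ π : Measure ℝ}
    [IsProbabilityMeasure σ] (hσ : ∀ᵐ s ∂σ, 0 ≤ s) (hπ : IsStationarySystemTimeLaw lam σ π) :
    ∀ᵐ x ∂π, 0 ≤ x := by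
  have hexp := isProbabilityMeasure_expMeasure hlam
  have := hπ.1
  rw [← hπ.2, ae_map_iff (by fun_prop) measurableSet_Ici]
  have h1 : ∀ᵐ p ∂((expMeasure lam).prod σ), 0 ≤ p.2 := Measure.quasiMeasurePreserving_snd.ae hσ
  have h2 : ∀ᵐ p ∂(π.prod ((expMeasure lam).prod σ)), 0 ≤ p.2.2 :=
    Measure.quasiMeasurePreserving_snd.ae h1
  filter_upwards [h2] with p hp
  exact add_nonneg (le_max_right _ _) hp

theorem IsStationarySystemTimeLaw.lintegral_eq {lam : ℝ} (hlam : 0 < lam) {σ π : Measure ℝ}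
    [IsProbabilityMeasure σ] (hπ : IsStationarySystemTimeLaw lam σ π) {g : ℝ → ENNReal}
    (hg : Measurable g) :
    ∫⁻ t, ∫⁻ y, g (max (t - y.1) 0 + y.2) ∂((expMeasure lam).prod σ) ∂π = ∫⁻ t, g t ∂π := by
  have hexp := isProbabilityMeasure_expMeasure hlam
  have := hπ.1
  have hf : Measurable fun p : ℝ × ℝ × ℝ => g (max (p.1 - p.2.1) 0 + p.2.2) := by fun_prop
  conv_rhs => rw [← hπ.2]
  rw [lintegral_map hg (by fun_prop), lintegral_prod _ hf.aemeasurable]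

namespace UpdateDecideSystem.IsMG1M

variable {Ω : Type*} {Q : UpdateDecideSystem Ω} [MeasurableSpace Ω] {P : Measure Ω}
  {lam μ ν : ℝ} {σ π : Measure ℝ}

/-- Invariance of π under the recursion, with the random initial state realised as a separate
integration variable x. Thus `Q` need not itself start from π. -/
theorem lintegral_systemTime_withInitial [IsProbabilityMeasure P] [IsProbabilityMeasure σ]
    (hQ : Q.IsMG1M P lam σ ν) (hlam : 0 < lam) (hσ_nonneg : ∀ᵐ s ∂σ, 0 ≤ s)
    (hπ : IsStationarySystemTimeLaw lam σ π) (k : ℕ) {g : ℝ → ENNReal} (hg : Measurable g) :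
    ∫⁻ x, ∫⁻ ω, g ((Q.withInitial x).systemTime k ω) ∂P ∂π = ∫⁻ x, g x ∂π := by
  have hexp := isProbabilityMeasure_expMeasure hlam
  induction k generalizing g with
  | zero =>
    simp only [systemTime_zero]
    simp [UpdateDecideSystem.withInitial]
  | succ k ih =>
    have hf : Measurable fun p : ℝ × ℝ × ℝ => g (max (p.1 - p.2.1) 0 + p.2.2) := by fun_prop
    rw [← hπ.lintegral_eq hlam hg, ← ih hf.lintegral_prod_right']
    refine lintegral_congr_ae ((hπ.ae_nonneg hlam hσ_nonneg).mono fun x hx => ?_)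
    exact (hQ.withInitial hx).lintegral_systemTime_succ hlam hg k

/-- The law of the system time of update `k` in the system that is empty at time `0` converges to
any stationary law. -/
theorem tendsto_map_systemTime_withInitial [IsProbabilityMeasure P] [IsProbabilityMeasure σ]
    (hQ : Q.IsMG1M P lam σ ν) (hlam : 0 < lam) (hρ : lam < μ)
    (hσ_nonneg : ∀ᵐ s ∂σ, 0 ≤ s) (hσ_int : Integrable (fun s : ℝ => s) σ)
    (hσ_mean : ∫ s, s ∂σ = 1 / μ) (hπ : IsStationarySystemTimeLaw lam σ π) {A : Set ℝ}
    (hA : MeasurableSet A) :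
    Tendsto (fun k => (P.map ((Q.withInitial 0).systemTime k)).real A) atTop
      (𝓝 (π.real A)) := by
  have := hπ.1
  have hQ0 := hQ.withInitial le_rfl
  -- On the product space, `Φ` is the stationary system and `T0` below the initially empty one, both
  -- driven by the same input.
  set Φ : ℕ → ℝ × Ω → ℝ := fun k p => max p.1 ((Q.withInitial 0).unservedTime k p.2) +
      ∑ i ∈ Finset.range k, Q.S i p.2 - Q.arrival k p.2 with hΦ
  have hV : ∀ k, Measurable ((Q.withInitial 0).unservedTime k) := fun k =>
    (hQ0.measurable_departure k).sub (Finset.measurable_fun_sum _ fun i _ => hQ0.measurable_S i)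
  have hΦm : ∀ k, Measurable (Φ k) := by
    intro k
    have h1 := measurable_arrival hQ.measurable_X k
    have h2 := hQ.measurable_S
    have h3 := hV k
    fun_prop
  have hnn : ∀ᵐ p ∂(π.prod P), 0 ≤ p.1 :=
    Measure.quasiMeasurePreserving_fst.ae (hπ.ae_nonneg hlam hσ_nonneg)
  have hmap : ∀ k, (π.prod P).map (Φ k) = π := by
    intro k
    refine Measure.ext_of_lintegral _ fun g hg => ?_
    rw [lintegral_map hg (hΦm k), lintegral_prod (fun p => g (Φ k p))
      (hg.comp (hΦm k)).aemeasurable,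
      ← hQ.lintegral_systemTime_withInitial hlam hσ_nonneg hπ k hg]
    refine lintegral_congr_ae ((hπ.ae_nonneg hlam hσ_nonneg).mono fun x hx => ?_)
    simp only [hΦ, Q.systemTime_withInitial hx]
  have htop : ∀ᵐ ω ∂P, Tendsto (fun k => (Q.withInitial 0).unservedTime k ω) atTop atTop := by
    filter_upwards [hQ0.ae_tendsto_unservedTime_div hlam hρ hσ_int hσ_mean] with ω hω
    have hc : 0 < 1 / lam - 1 / μ := sub_pos.2 (one_div_lt_one_div_of_lt hlam hρ)
    exact (hω.pos_mul_atTop hc tendsto_natCast_atTop_atTop).congr'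
      ((eventually_ge_atTop 1).mono fun n hn => div_mul_cancel₀ _ (by positivity))
  have htop' : ∀ᵐ p ∂(π.prod P),
      Tendsto (fun k => (Q.withInitial 0).unservedTime k p.2) atTop atTop :=
    Measure.quasiMeasurePreserving_snd.ae htop
  set T0 : ℕ → ℝ × Ω → ℝ := fun k p => (Q.withInitial 0).systemTime k p.2 with hT0
  have hT0m : ∀ k, Measurable (T0 k) := fun k => (hQ0.measurable_systemTime k).comp measurable_snd
  have hone : ∀ {f : ℝ × Ω → ℝ}, Measurable f →
      Integrable (fun p => A.indicator (1 : ℝ → ℝ) (f p)) (π.prod P) := fun hf =>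
    Integrable.of_bound (C := 1) ((measurable_one.indicator hA).comp hf).aestronglyMeasurable
      (ae_of_all _ fun p => (norm_indicator_le_norm_self _ _).trans (by simp))
  have hreal : ∀ {f : ℝ × Ω → ℝ}, Measurable f →
      ∫ p, A.indicator (1 : ℝ → ℝ) (f p) ∂(π.prod P) = ((π.prod P).map f).real A := fun hf => by
    rw [← integral_indicator_one hA, integral_map hf.aemeasurable
      (measurable_one.indicator hA).aestronglyMeasurable]
  have hdiff : Tendsto (fun k => ∫ p, (A.indicator (1 : ℝ → ℝ) (Φ k p) -
      A.indicator (1 : ℝ → ℝ) (T0 k p)) ∂(π.prod P)) atTop (𝓝 (∫ _, (0 : ℝ) ∂(π.prod P))) := by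
    refine tendsto_integral_of_dominated_convergence (fun _ => (2 : ℝ))
      (fun k => ((hone (hΦm k)).sub (hone (hT0m k))).aestronglyMeasurable) (integrable_const _)
      (fun k => ae_of_all _ fun p => ?_) ?_
    · refine (norm_sub_le _ _).trans ?_
      have h1 : ∀ t : ℝ, ‖A.indicator (1 : ℝ → ℝ) t‖ ≤ 1 := fun t =>
        (norm_indicator_le_norm_self _ _).trans (by simp)
      linarith [h1 (Φ k p), h1 (T0 k p)]
    · filter_upwards [htop', hnn] with p hp hp0
      refine tendsto_const_nhds.congr' ?_
      -- Once the unserved time of the initially empty system exceeds x, both maxima equal it and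
      -- the two system times agree from then on.
      filter_upwards [hp.eventually_ge_atTop p.1] with k hk
      have h1 : Φ k p = T0 k p := by
        simp only [hΦ, hT0]
        rw [Q.systemTime_withInitial le_rfl, max_eq_right hk, max_eq_right (hp0.trans hk)]
      rw [h1, sub_self]
  have hmap0 : ∀ k, ((π.prod P).map (T0 k)).real A =
      (P.map ((Q.withInitial 0).systemTime k)).real A := by
    intro k
    have h1 : (π.prod P).map (T0 k) = P.map ((Q.withInitial 0).systemTime k) := by
      have h2 : T0 k = (Q.withInitial 0).systemTime k ∘ Prod.snd := rfl
      rw [h2, ← Measure.map_map (hQ0.measurable_systemTime k) measurable_snd,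
        Measure.map_snd_prod, measure_univ, one_smul]
    rw [h1]
  have h4 : ∀ k, ∫ p, (A.indicator (1 : ℝ → ℝ) (Φ k p) -
      A.indicator (1 : ℝ → ℝ) (T0 k p)) ∂(π.prod P) =
      π.real A - (P.map ((Q.withInitial 0).systemTime k)).real A := by
    intro k
    rw [integral_sub (hone (hΦm k)) (hone (hT0m k)), hreal (hΦm k), hreal (hT0m k), hmap, hmap0]
  simp only [h4, integral_zero] at hdiff
  have h5 := hdiff.const_sub (π.real A)
  simpa using h5

theorem stationaryLaw_unique [IsProbabilityMeasure P] [IsProbabilityMeasure σ]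
    (hQ : Q.IsMG1M P lam σ ν) (hlam : 0 < lam) (hρ : lam < μ)
    (hσ_nonneg : ∀ᵐ s ∂σ, 0 ≤ s) (hσ_int : Integrable (fun s : ℝ => s) σ)
    (hσ_mean : ∫ s, s ∂σ = 1 / μ) {π₁ π₂ : Measure ℝ}
    (h₁ : IsStationarySystemTimeLaw lam σ π₁) (h₂ : IsStationarySystemTimeLaw lam σ π₂) :
    π₁ = π₂ := by
  have := h₁.1
  have := h₂.1
  refine Measure.ext fun A hA => ?_
  rw [← ofReal_measureReal, ← ofReal_measureReal,
    tendsto_nhds_unique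
      (hQ.tendsto_map_systemTime_withInitial hlam hρ hσ_nonneg hσ_int hσ_mean h₁ hA)
      (hQ.tendsto_map_systemTime_withInitial hlam hρ hσ_nonneg hσ_int hσ_mean h₂ hA)]

end UpdateDecideSystem.IsMG1M

/-! ### Loynes' construction and existence of the stationary law -/

/-- The maximum of the random walk with steps `u`, started at `0`. -/
noncomputable def walkSup (u : ℕ → ℝ) : ℝ := iSup fun n => ∑ i ∈ Finset.range n, u i

theorem measurable_walkSup : Measurable walkSup :=
  Measurable.iSup fun _ => Finset.measurable_fun_sum _ fun i _ => measurable_pi_apply i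

/-- Separate the empty partial sum from the others, all of which contain the first step. Boundedness
is needed because `iSup` takes a default value on unbounded families. -/
theorem walkSup_eq_max {u : ℕ → ℝ}
    (hu : BddAbove (Set.range fun n => ∑ i ∈ Finset.range n, u i)) :
    walkSup u = max (walkSup (fun i => u (i + 1)) + u 0) 0 := by
  have hshift : ∀ n, ∑ i ∈ Finset.range (n + 1), u i =
      ∑ i ∈ Finset.range n, u (i + 1) + u 0 := fun n => Finset.sum_range_succ' _ _
  have hu' : BddAbove (Set.range fun n => ∑ i ∈ Finset.range n, u (i + 1)) := by
    obtain ⟨b, hb⟩ := hu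
    refine ⟨b - u 0, ?_⟩
    rintro _ ⟨n, rfl⟩
    have := hb ⟨n + 1, rfl⟩
    simp only [hshift] at this
    simp only
    linarith
  refine le_antisymm (ciSup_le fun n => ?_) (max_le ?_ ?_)
  · rcases n with _ | n
    · simp
    · rw [hshift]
      exact le_max_of_le_left (add_le_add_left (le_ciSup hu' n) _)
  · rw [← le_sub_iff_add_le]
    refine ciSup_le fun n => ?_
    rw [le_sub_iff_add_le, ← hshift]
    exact le_ciSup hu (n + 1)
  · exact (Finset.sum_range_zero u).symm.le.trans (le_ciSup hu 0)

namespace UpdateDecideSystem.IsMG1M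

variable {Ω : Type*} {Q : UpdateDecideSystem Ω} [MeasurableSpace Ω] {P : Measure Ω}
  {lam μ ν : ℝ} {σ : Measure ℝ}

/-- The walk has negative drift 1/μ - 1/λ, so its partial sums are eventually nonpositive and
finitely many terms remain. -/
theorem ae_bddAbove_walk (hQ : Q.IsMG1M P lam σ ν) (hlam : 0 < lam)
    (hρ : lam < μ) (hσ_int : Integrable (fun s : ℝ => s) σ) (hσ_mean : ∫ s, s ∂σ = 1 / μ) :
    ∀ᵐ ω ∂P, BddAbove (Set.range fun n => ∑ i ∈ Finset.range n, (Q.S i ω - Q.X i ω)) := by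
  filter_upwards [hQ.ae_tendsto_average_X hlam, hQ.ae_tendsto_average_S hσ_int hσ_mean]
    with ω hX hS
  have hc : 1 / μ - 1 / lam < 0 := sub_neg.2 (one_div_lt_one_div_of_lt hlam hρ)
  have h := (tendsto_order.1 (hS.sub hX)).2 0 hc
  refine Filter.IsBoundedUnder.bddAbove_range ⟨0, ?_⟩
  rw [eventually_map]
  filter_upwards [h, eventually_ge_atTop 1] with n hn hn1
  have hn0 : (0 : ℝ) < n := by exact_mod_cast hn1
  rw [← sub_div, div_lt_iff₀ hn0, zero_mul] at hn
  rw [Finset.sum_sub_distrib]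
  exact hn.le

/-- The joint law of the inputs is an infinite product of laws that do not depend on the index,
hence it is invariant under the shift. -/
theorem map_walkSup_shift [IsProbabilityMeasure P] (hQ : Q.IsMG1M P lam σ ν) :
    P.map (fun ω => walkSup fun i => Q.S (i + 1) ω - Q.X (i + 1) ω) =
      P.map (fun ω => walkSup fun i => Q.S i ω - Q.X i ω) := by
  set d : ℕ ⊕ ℕ → Ω → ℝ := Sum.elim Q.X Q.S with hd
  set d' : ℕ ⊕ ℕ → Ω → ℝ := fun i => d (Sum.map (· + 1) (· + 1) i) with hd'
  have hdm : ∀ i, Measurable (d i) := by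
    rintro (i | i)
    exacts [hQ.measurable_X i, hQ.measurable_S i]
  have hinj : Function.Injective (Sum.map id Sum.inl : ℕ ⊕ ℕ → ℕ ⊕ ℕ ⊕ ℕ ⊕ Unit) :=
    Function.injective_id.sumMap Sum.inl_injective
  have hind : iIndepFun d P := by
    have h := hQ.indep.precomp hinj
    convert h using 1
    funext i
    rcases i with i | i <;> rfl
  have hind' : iIndepFun d' P :=
    hind.precomp ((add_left_injective 1).sumMap (add_left_injective 1))
  have hlaw : ∀ i, P.map (d' i) = P.map (d i) := by
    rintro (i | i)
    · exact (hQ.law_X (i + 1)).trans (hQ.law_X i).symm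
    · exact (hQ.law_S (i + 1)).trans (hQ.law_S i).symm
  have hlaws : P.map (fun ω i => d' i ω) = P.map (fun ω i => d i ω) := by
    rw [hind.map_fun_eq_infinitePi_map hdm, hind'.map_fun_eq_infinitePi_map fun i => hdm _]
    exact congrArg Measure.infinitePi (funext hlaw)
  have hF : Measurable fun u : ℕ ⊕ ℕ → ℝ => walkSup fun i => u (.inr i) - u (.inl i) :=
    measurable_walkSup.comp (measurable_pi_iff.2 fun i =>
      (measurable_pi_apply _).sub (measurable_pi_apply _))
  have h1 := congrArg (Measure.map fun u : ℕ ⊕ ℕ → ℝ =>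
    walkSup fun i => u (.inr i) - u (.inl i)) hlaws
  rw [Measure.map_map hF (measurable_pi_iff.2 fun i => hdm _),
    Measure.map_map hF (measurable_pi_iff.2 hdm)] at h1
  exact h1

theorem indepFun_walkSup_S_X [IsProbabilityMeasure P] (hQ : Q.IsMG1M P lam σ ν) :
    IndepFun (fun ω => walkSup fun i => Q.S (i + 1) ω - Q.X (i + 1) ω)
      (fun ω => (Q.S 0 ω, Q.X 0 ω)) P := by
  set B : Set (ℕ ⊕ ℕ ⊕ ℕ ⊕ Unit) := {.inl 0, .inr (.inl 0)} with hB
  have h := hQ.indep.indepFun_restrictedTuple hQ.measurable_data (disjoint_compl_left (a := B))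
  have hm1 : Measurable fun u : ℕ ⊕ ℕ ⊕ ℕ ⊕ Unit → ℝ =>
      walkSup fun i => u (.inr (.inl (i + 1))) - u (.inl (i + 1)) :=
    measurable_walkSup.comp (measurable_pi_iff.2 fun i =>
      (measurable_pi_apply _).sub (measurable_pi_apply _))
  have hm2 : Measurable fun u : ℕ ⊕ ℕ ⊕ ℕ ⊕ Unit → ℝ => (u (.inr (.inl 0)), u (.inl 0)) :=
    (measurable_pi_apply _).prodMk (measurable_pi_apply _)
  have h2 := h.comp hm1 hm2
  refine h2.congr (ae_of_all _ fun ω => ?_) (ae_of_all _ fun ω => ?_)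
  · refine congrArg walkSup (funext fun i => ?_)
    refine congrArg₂ (· - ·) ?_ ?_
    · exact restrictedTuple_apply Q.data Bᶜ ω (i := .inr (.inl (i + 1))) (by simp [hB])
    · exact restrictedTuple_apply Q.data Bᶜ ω (i := .inl (i + 1)) (by simp [hB])
  · refine Prod.ext ?_ ?_
    · exact restrictedTuple_apply Q.data B ω (i := .inr (.inl 0)) (by simp [hB])
    · exact restrictedTuple_apply Q.data B ω (i := .inl 0) (by simp [hB])

/-- Loynes' construction: a service time plus the maximum of the random walk whose steps are the
differences of service times and inter-arrival times has a stationary law. -/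
theorem isStationarySystemTimeLaw_walkSup [IsProbabilityMeasure P] [IsProbabilityMeasure σ]
    (hQ : Q.IsMG1M P lam σ ν) (hlam : 0 < lam) (hρ : lam < μ)
    (hσ_int : Integrable (fun s : ℝ => s) σ) (hσ_mean : ∫ s, s ∂σ = 1 / μ) :
    IsStationarySystemTimeLaw lam σ
      (((P.map fun ω => walkSup fun i => Q.S i ω - Q.X i ω).prod σ).map fun p => p.1 + p.2) := by
  have hexp := isProbabilityMeasure_expMeasure hlam
  have hW : Measurable fun ω => walkSup fun i => Q.S i ω - Q.X i ω :=
    measurable_walkSup.comp (measurable_pi_iff.2 fun i =>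
      (hQ.measurable_S i).sub (hQ.measurable_X i))
  have hW' : Measurable fun ω => walkSup fun i => Q.S (i + 1) ω - Q.X (i + 1) ω :=
    measurable_walkSup.comp (measurable_pi_iff.2 fun i =>
      (hQ.measurable_S (i + 1)).sub (hQ.measurable_X (i + 1)))
  have hSX : Measurable fun ω => (Q.S 0 ω, Q.X 0 ω) :=
    (hQ.measurable_S 0).prodMk (hQ.measurable_X 0)
  set w := P.map fun ω => walkSup fun i => Q.S i ω - Q.X i ω with hw
  have hwP : IsProbabilityMeasure w := Measure.isProbabilityMeasure_map hW.aemeasurable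
  have hlawSX : P.map (fun ω => (Q.S 0 ω, Q.X 0 ω)) = σ.prod (expMeasure lam) := by
    have h : IndepFun (Q.S 0) (Q.X 0) P :=
      hQ.indep.indepFun (i := .inr (.inl 0)) (j := .inl 0) (by simp)
    rw [(indepFun_iff_map_prod_eq_prod_map_map (hQ.measurable_S 0).aemeasurable
      (hQ.measurable_X 0).aemeasurable).1 h, hQ.law_X, hQ.law_S]
  have hjoint : P.map (fun ω => (walkSup fun i => Q.S (i + 1) ω - Q.X (i + 1) ω,
      (Q.S 0 ω, Q.X 0 ω))) = w.prod (σ.prod (expMeasure lam)) := by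
    rw [(indepFun_iff_map_prod_eq_prod_map_map hW'.aemeasurable hSX.aemeasurable).1
      hQ.indepFun_walkSup_S_X, hQ.map_walkSup_shift, hlawSX]
  -- The supremum W equals max(W' + S - X, 0), where W' is the supremum of the shifted walk: it has
  -- the law of W and is independent of (S, X). So w is invariant under the waiting-time recursion.
  have hfix : ∀ h : ℝ → ENNReal, Measurable h →
      ∫⁻ v, ∫⁻ s, ∫⁻ x, h (max (v + s - x) 0) ∂(expMeasure lam) ∂σ ∂w = ∫⁻ v, h v ∂w := by
    intro h hh
    have hm : Measurable fun p : ℝ × ℝ × ℝ => h (max (p.1 + p.2.1 - p.2.2) 0) := by fun_prop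
    have h1 : ∫⁻ v, h v ∂w = ∫⁻ p, h (max (p.1 + p.2.1 - p.2.2) 0)
        ∂(w.prod (σ.prod (expMeasure lam))) := by
      rw [← hjoint, lintegral_map hm (hW'.prodMk hSX), hw, lintegral_map hh hW]
      refine lintegral_congr_ae ?_
      filter_upwards [hQ.ae_bddAbove_walk hlam hρ hσ_int hσ_mean] with ω hω
      rw [walkSup_eq_max hω, add_sub_assoc]
    rw [h1, lintegral_prod _ hm.aemeasurable]
    refine lintegral_congr fun v => ?_
    exact (lintegral_prod _ (hm.comp (measurable_prodMk_left (x := v))).aemeasurable).symm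
  refine ⟨Measure.isProbabilityMeasure_map (by fun_prop), ?_⟩
  refine Measure.ext_of_lintegral _ fun g hg => ?_
  have hm : Measurable fun p : ℝ × ℝ × ℝ => g (max (p.1 - p.2.1) 0 + p.2.2) := by fun_prop
  have hπP : IsProbabilityMeasure ((w.prod σ).map fun p => p.1 + p.2) :=
    Measure.isProbabilityMeasure_map (by fun_prop)
  have hmv : Measurable fun v : ℝ => ∫⁻ s, g (v + s) ∂σ :=
    Measurable.lintegral_prod_right' (f := fun p : ℝ × ℝ => g (p.1 + p.2)) (by fun_prop)
  rw [lintegral_map hg (by fun_prop), lintegral_prod _ hm.aemeasurable,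
    lintegral_map hm.lintegral_prod_right' (by fun_prop),
    lintegral_map hg (by fun_prop),
    -- A system time is a waiting time plus a service time: applying `hfix` to v ↦ ∫ g(v + s) dσ(s)
    -- turns invariance of w into invariance of the law of the sum.
    lintegral_prod (fun p : ℝ × ℝ => g (p.1 + p.2)) (by fun_prop), ← hfix _ hmv]
  refine (lintegral_prod _ (hm.lintegral_prod_right'.comp
    (measurable_fst.add measurable_snd)).aemeasurable).trans ?_
  refine lintegral_congr fun v => lintegral_congr fun s => ?_
  exact lintegral_prod _ (hm.comp (measurable_prodMk_left (x := v + s))).aemeasurable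

end UpdateDecideSystem.IsMG1M

/-! ### The main theorem -/

theorem theorem3 (lam μ ν : ℝ) (hlam : 0 < lam) (hν : 0 < ν) (hρ : lam < μ)
    (σ : Measure ℝ) [IsProbabilityMeasure σ] (hσ_nonneg : ∀ᵐ s ∂σ, 0 ≤ s)
    (hσ_int : Integrable (fun s : ℝ => s) σ) (hσ_mean : ∫ s, s ∂σ = 1 / μ)
    {Ω : Type*} [MeasurableSpace Ω] (P : Measure Ω) [IsProbabilityMeasure P]
    (Q : UpdateDecideSystem Ω) (hQ : Q.IsMG1M P lam σ ν) :
    -- the long-run fraction of missed updates among the received ones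
    (∀ᵐ ω ∂P, Tendsto (fun n : ℕ => (Q.numMissed n ω : ℝ) / n) atTop
      (𝓝 (mgf id σ (-ν) * ((lam / μ * ν + lam) / (lam + ν))))) ∧
    -- the stationary regime exists and is unique
    (∃! π : Measure ℝ, IsStationarySystemTimeLaw lam σ π) ∧
    -- the missing probability of every update in the stationary regime
    (IsStationarySystemTimeLaw lam σ (P.map Q.T₀) → ∀ k : ℕ,
      P.real {ω | Q.Missed k ω} = mgf id σ (-ν) * ((lam / μ * ν + lam) / (lam + ν)) ∧
      P.real {ω | Q.numDecisions k ω = 0} =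
        mgf id σ (-ν) * ((lam / μ * ν + lam) / (lam + ν)) ∧
      ∫ ω, Real.exp (-ν * Q.interDeparture k ω) ∂P =
        mgf id σ (-ν) * ((lam / μ * ν + lam) / (lam + ν))) := by
  refine ⟨hQ.ae_tendsto_numMissed_div hlam hν hρ hσ_nonneg hσ_int hσ_mean, ?_, fun hstat k => ?_⟩
  · exact ⟨_, hQ.isStationarySystemTimeLaw_walkSup hlam hρ hσ_int hσ_mean, fun π hπ =>
      hQ.stationaryLaw_unique hlam hρ hσ_nonneg hσ_int hσ_mean hπ
        (hQ.isStationarySystemTimeLaw_walkSup hlam hρ hσ_int hσ_mean)⟩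
  · have h1 := hQ.integral_exp_interDeparture hlam hν hρ hσ_nonneg hσ_int hσ_mean hstat k
    have h2 := hQ.measureReal_numDecisions_eq_zero hlam hν hσ_nonneg k
    have h3 : P.real {ω | Q.Missed k ω} = P.real {ω | Q.numDecisions k ω = 0} := by
      refine measureReal_congr ?_
      filter_upwards [hQ.ae_nonneg hlam hν hσ_nonneg] with ω ⟨_, _, hS, _⟩
      exact propext (UpdateDecideSystem.missed_iff_numDecisions_eq_zero hS)
    exact ⟨h3.trans (h2.trans h1), h2.trans h1, h1⟩
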